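/- Let $d\ge 1$ and $\hbar\in(0,1)$. On the Hilbert space $L^2(\mathbb R^d,\mathrm dq)\otimes\Gamma_s(L^2(\mathbb R^d,\mathrm dk))=\bigoplus_{n\ge 0}L^2(\mathbb R^d)\otimes L^2(\mathbb R^d)^{\otimes_s n}$, where $\Gamma_s$ is the bosonic Fock space, consider the free Hamiltonian $H^0_\hbar=\tfrac12|\hat p|^2+N_\hbar$. Here $\hat p=-i\hbar\nabla_q$ and $N_\hbar=\mathrm d\Gamma_\hbar(1)$ is multiplication by $\hbar n$ on the $n$-boson sector. Its form domain is $Q(H^0_\hbar)=\bigcap_{j=1}^d D(\hat p_j)\cap D(N_\hbar^{1/2})$, and its form is $q_0(\varphi,\psi)=\tfrac12\sum_{j}\langle\hat p_j\varphi,\hat p_j\psi\rangle+\langle N_\hbar^{1/2}\varphi,N_\hbar^{1/2}\psi\rangle$. For $0\le\Lambda\le\infty$ put $$f^\Lambda_q(k)=\frac{e^{-ik\cdot q}\,\mathbf 1_{|k|\le\Lambda}}{|k|^{(d-1)/2}},\qquad \phi_\hbar(f^\Lambda_{\hat q})=\tfrac1{\sqrt2}\bigl(a_\hbar(f^\Lambda_{\hat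 q})+a_\hbar^*(f^\Lambda_{\hat q})\bigr),$$ where $$(a_\hbar(f_{\hat q})\psi)_n(q,k_1,\dots,k_n)=\sqrt{\hbar(n+1)}\int\overline{f_q(k)}\,\psi_{n+1}(q,k,k_1,\dots,k_n)\,\mathrm dk,$$ $$(a^*_\hbar(f_{\hat q})\psi)_{n+1}(q,k_1,\dots,k_{n+1})=\frac{\sqrt{\hbar(n+1)}}{n+1}\sum_{i=1}^{n+1}f_q(k_i)\,\psi_n(q,k_1,\dots,\widehat{k_i},\dots,k_{n+1}),\qquad (a^*_\hbar(f_{\hat q})\psi)_0=0.$$ Then the Fröhlich Hamiltonian without cutoff, $H^\infty_\hbar=H^0_\hbar+\phi_\hbar(f^\infty_{\hat q})$, is a well-defined, closed, bounded below quadratic form with form domain $Q(H^0_\hbar)$. More precisely, $Q(H^0_\hbar)$ is dense, and there is a sesquilinear form $w$ on $Q(H^0_\hbar)$, the form of $\phi_\hbar(f^\infty_{\hat q})$, with the following properties. 1. For all $\varphi,\psi\in Q(H^0_\hbar)$, $w(\varphi,\psi)=\lim_{\Lambda\to\infty}\langle\varphi,\phi_\hbar(f^\Lambda_{\hat q})\psi\rangle$.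 Moreover, $w(\varphi,\psi)$ equals the expression $\langle\varphi,\phi_\hbar(f^\infty_{\hat q})\psi\rangle$, with $\Lambda=\infty$ inserted directly, whenever the sums and integrals defining $\langle\varphi,a_\hbar(f^\infty_{\hat q})\psi\rangle$ and $\langle\psi,a_\hbar(f^\infty_{\hat q})\varphi\rangle$ converge absolutely. 2. $w$ is infinitesimally form-bounded with respect to $H^0_\hbar$: for every $\varepsilon>0$ there is $C_\varepsilon$ such that $|w(\psi,\psi)|\le\varepsilon\,q_0(\psi,\psi)+C_\varepsilon\|\psi\|^2$ for all $\psi\in Q(H^0_\hbar)$. 3. The form $q_0+w$ of $H^\infty_\hbar$, with domain $Q(H^0_\hbar)$, is Hermitian, bounded below and closed. -/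

import Mathlib

noncomputable section

open MeasureTheory Filter Topology
open scoped ENNReal NNReal ComplexConjugate ContDiff

namespace Polaron

/-! ### Sesquilinear (quadratic) forms on a subspace of a Hilbert space -/

section Forms

variable {H : Type*} [NormedAddCommGroup H] [InnerProductSpace ℂ H]

/-- Sesquilinear forms with form domain `Q`, conjugate-linear in the first argument. -/
abbrev SesqForm (Q : Submodule ℂ H) : Type _ := Q →ₗ⋆[ℂ] Q →ₗ[ℂ] ℂ

/-- `h` is Hermitian, i.e. its quadratic form `ψ ↦ h ψ ψ` is real. -/
def IsHermitianForm {Q : Submodule ℂ H} (h : SesqForm Q) : Prop :=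
  ∀ φ ψ : Q, h ψ φ = conj (h φ ψ)

/-- `h ψ ψ ≥ m ‖ψ‖²` for some real `m`. -/
def IsBoundedBelowForm {Q : Submodule ℂ H} (h : SesqForm Q) : Prop :=
  ∃ m : ℝ, ∀ ψ : Q, m * ‖(ψ : H)‖ ^ 2 ≤ (h ψ ψ).re

/-- `h` is closed: if `uₖ ∈ Q` converges to `x` in `H` and `h (uₖ - uₗ) (uₖ - uₗ) → 0`, then
`x ∈ Q` and `h (uₖ - x) (uₖ - x) → 0`. -/
def IsClosedForm {Q : Submodule ℂ H} (h : SesqForm Q) : Prop :=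
  ∀ (u : ℕ → Q) (x : H), Tendsto (fun k => (u k : H)) atTop (𝓝 x) →
    Tendsto (fun p : ℕ × ℕ => h (u p.1 - u p.2) (u p.1 - u p.2)) atTop (𝓝 0) →
    ∃ y : Q, (y : H) = x ∧ Tendsto (fun k => h (u k - y) (u k - y)) atTop (𝓝 0)

/-- `w` is infinitesimally form-bounded with respect to `h₀`. -/
def IsInfinitesimallyFormBounded {Q : Submodule ℂ H} (w h₀ : SesqForm Q) : Prop :=
  ∀ ε : ℝ, 0 < ε → ∃ C : ℝ, ∀ ψ : Q, ‖w ψ ψ‖ ≤ ε * (h₀ ψ ψ).re + C * ‖(ψ : H)‖ ^ 2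

end Forms

/-! ### The Hilbert space `L²(ℝᵈ) ⊗ Γₛ(L²(ℝᵈ))` -/

/-- `ℝᵈ` with its Euclidean norm. -/
abbrev Rd (d : ℕ) : Type := EuclideanSpace ℝ (Fin d)

/-- The points `(q, (k₁, …, kₙ))`: particle position and the momenta of `n` bosons. -/
abbrev Config (d n : ℕ) : Type := Rd d × (Fin n → Rd d)

/-- Relabelling of the bosons. -/
def permute (d n : ℕ) (σ : Equiv.Perm (Fin n)) (x : Config d n) : Config d n :=
  (x.1, fun i => x.2 (σ i))

lemma measurePreserving_permute (d n : ℕ) (σ : Equiv.Perm (Fin n)) :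
    MeasurePreserving (permute d n σ) volume volume := by
  have h := volume_measurePreserving_piCongrLeft (fun _ : Fin n => Rd d) σ.symm
  have h2 := (MeasurePreserving.id (volume : Measure (Rd d))).prod h
  have h3 : permute d n σ =
      Prod.map id (MeasurableEquiv.piCongrLeft (fun _ : Fin n => Rd d) σ.symm) := by
    funext x
    refine Prod.ext rfl ?_
    funext i
    have := MeasurableEquiv.piCongrLeft_apply_apply (β := fun _ : Fin n => Rd d) σ.symm x.2 (σ i)
    simpa [permute] using this.symm
  rw [h3]
  exact h2

/-- The `n`-boson sector `L²(ℝᵈ) ⊗ L²(ℝᵈ)^{⊗ₛ n}`, realized as the square-integrable functions of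
`(q, k₁, …, kₙ)` that are invariant under permutations of `k₁, …, kₙ`. -/
def Sector (d n : ℕ) : Submodule ℂ (Lp ℂ 2 (volume : Measure (Config d n))) where
  carrier := {u | ∀ σ : Equiv.Perm (Fin n), (fun x => u (permute d n σ x)) =ᵐ[volume] u}
  zero_mem' := by
    intro σ
    have h := Lp.coeFn_zero ℂ 2 (volume : Measure (Config d n))
    filter_upwards [h, (measurePreserving_permute d n σ).quasiMeasurePreserving.ae h] with x h1 h2
    rw [h1, h2]; rfl
  add_mem' := by
    intro u v hu hv σ
    have h := Lp.coeFn_add u v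
    filter_upwards [h, (measurePreserving_permute d n σ).quasiMeasurePreserving.ae h, hu σ, hv σ]
      with x h1 h2 h3 h4
    rw [h1, h2, Pi.add_apply, Pi.add_apply, h3, h4]
  smul_mem' := by
    intro c u hu σ
    have h := Lp.coeFn_smul c u
    filter_upwards [h, (measurePreserving_permute d n σ).quasiMeasurePreserving.ae h, hu σ]
      with x h1 h2 h3
    rw [h1, h2, Pi.smul_apply, Pi.smul_apply, h3]

/-- The Hilbert space `L²(ℝᵈ) ⊗ Γₛ(L²(ℝᵈ)) = ⨁ₙ L²(ℝᵈ) ⊗ L²(ℝᵈ)^{⊗ₛ n}` (Hilbert direct sum). -/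
abbrev Space (d : ℕ) : Type := lp (fun n : ℕ => Sector d n) 2

/-- The `n`-boson wave function `ψₙ(q, k₁, …, kₙ)` of a vector. -/
def wave {d : ℕ} (ψ : Space d) (n : ℕ) : Config d n → ℂ :=
  ((ψ n : Lp ℂ 2 (volume : Measure (Config d n))) : Config d n → ℂ)

/-! ### The free Hamiltonian -/

/-- The partial derivative of `g` in the `j`-th coordinate of the particle position `q`. -/
def partialQ {d n : ℕ} (j : Fin d) (g : Config d n → ℝ) (x : Config d n) : ℝ :=
  fderiv ℝ g x (EuclideanSpace.single j 1, 0)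

lemma integrable_wave_mul {d : ℕ} (ψ : Space d) (n : ℕ) {g : Config d n → ℝ}
    (hg : Continuous g) (hc : HasCompactSupport g) :
    Integrable (fun x => g x • wave ψ n x) := by
  have h1 : MemLp (wave ψ n) 2 volume := Lp.memLp _
  have h2 : MemLp g 2 volume := hg.memLp_of_hasCompactSupport hc
  exact memLp_one_iff_integrable.mp (h1.smul h2)

lemma continuous_partialQ {d n : ℕ} (j : Fin d) {g : Config d n → ℝ} (hg : ContDiff ℝ ∞ g) :
    Continuous (partialQ j g) :=
  (hg.continuous_fderiv (by simp)).clm_apply continuous_const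

lemma hasCompactSupport_partialQ {d n : ℕ} (j : Fin d) {g : Config d n → ℝ}
    (hc : HasCompactSupport g) : HasCompactSupport (partialQ j g) :=
  hc.fderiv_apply (𝕜 := ℝ) _

lemma wave_zero {d : ℕ} (n : ℕ) : wave (0 : Space d) n =ᵐ[volume] 0 :=
  Lp.coeFn_zero ℂ 2 (volume : Measure (Config d n))

lemma wave_add {d : ℕ} (φ ψ : Space d) (n : ℕ) :
    wave (φ + ψ) n =ᵐ[volume] wave φ n + wave ψ n :=
  Lp.coeFn_add (φ n : Lp ℂ 2 (volume : Measure (Config d n))) (ψ n)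

lemma wave_smul {d : ℕ} (c : ℂ) (ψ : Space d) (n : ℕ) :
    wave (c • ψ) n =ᵐ[volume] c • wave ψ n :=
  Lp.coeFn_smul c (ψ n : Lp ℂ 2 (volume : Measure (Config d n)))

/-- The graph of the momentum operator `p̂ⱼ = -i ħ ∂/∂qⱼ` on its maximal domain, the derivative
being the weak one: `χ = p̂ⱼ ψ` iff `∫ g χₙ = i ħ ∫ (∂g/∂qⱼ) ψₙ` for all `n` and all real test
functions `g`. -/
def momentumGraph (d : ℕ) (ħ : ℝ) (j : Fin d) : Submodule ℂ (Space d × Space d) where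
  carrier := {p | ∀ (n : ℕ) (g : Config d n → ℝ), ContDiff ℝ ∞ g → HasCompactSupport g →
    ∫ x, g x • wave p.2 n x = Complex.I * ħ * ∫ x, partialQ j g x • wave p.1 n x}
  zero_mem' := by
    intro n g _ _
    have h : ∀ r : Config d n → ℝ, ∫ x, r x • wave (0 : Space d) n x = 0 := by
      intro r
      refine integral_eq_zero_of_ae ?_
      filter_upwards [wave_zero (d := d) n] with x hx
      simp [hx]
    change ∫ x, g x • wave (0 : Space d) n x =
      Complex.I * ħ * ∫ x, partialQ j g x • wave (0 : Space d) n x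
    rw [h, h, mul_zero]
  add_mem' := by
    intro p p' hp hp' n g hg hc
    have h : ∀ (φ ψ : Space d) (r : Config d n → ℝ), Continuous r → HasCompactSupport r →
        ∫ x, r x • wave (φ + ψ) n x =
        (∫ x, r x • wave φ n x) + ∫ x, r x • wave ψ n x := by
      intro φ ψ r hr hrc
      rw [← integral_add (integrable_wave_mul φ n hr hrc) (integrable_wave_mul ψ n hr hrc)]
      refine integral_congr_ae ?_
      filter_upwards [wave_add φ ψ n] with x hx
      rw [hx, Pi.add_apply, smul_add]
    rw [Prod.snd_add, Prod.fst_add, h _ _ _ hg.continuous hc,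
      h _ _ _ (continuous_partialQ j hg) (hasCompactSupport_partialQ j hc),
      hp n g hg hc, hp' n g hg hc, mul_add]
  smul_mem' := by
    intro c p hp n g hg hc
    have h : ∀ (ψ : Space d) (r : Config d n → ℝ),
        ∫ x, r x • wave (c • ψ) n x = c * ∫ x, r x • wave ψ n x := by
      intro ψ r
      rw [← integral_const_mul]
      refine integral_congr_ae ?_
      filter_upwards [wave_smul c ψ n] with x hx
      rw [hx, Pi.smul_apply, smul_eq_mul, Complex.real_smul, Complex.real_smul]
      ring
    rw [Prod.smul_snd, Prod.smul_fst, h, h, hp n g hg hc]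
    ring

lemma momentumGraph_functional (d : ℕ) (ħ : ℝ) (j : Fin d) (p : Space d × Space d)
    (hp : p ∈ momentumGraph d ħ j) (h0 : p.1 = 0) : p.2 = 0 := by
  ext1
  funext n
  apply Subtype.ext
  apply Lp.ext
  have hz : ∀ r : Config d n → ℝ, ∫ x, r x • wave (0 : Space d) n x = 0 := by
    intro r
    refine integral_eq_zero_of_ae ?_
    filter_upwards [wave_zero (d := d) n] with x hx
    simp [hx]
  have hl : LocallyIntegrable (wave p.2 n) volume :=
    (Lp.memLp (p.2 n : Lp ℂ 2 (volume : Measure (Config d n)))).locallyIntegrable (by norm_num)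
  have := ae_eq_zero_of_integral_contDiff_smul_eq_zero hl (fun g hg hc => by
    rw [hp n g hg hc, h0, hz, mul_zero])
  refine EventuallyEq.trans (?_ : _ =ᵐ[volume] (0 : Config d n → ℂ)) (wave_zero (d := d) n).symm
  filter_upwards [this] with x hx
  exact hx

/-- The momentum operator `p̂ⱼ = -i ħ ∂/∂qⱼ`. -/
def momentum (d : ℕ) (ħ : ℝ) (j : Fin d) : Space d →ₗ.[ℂ] Space d :=
  (momentumGraph d ħ j).toLinearPMap

/-- The graph of `N_ħ^{1/2}`, where `N_ħ = dΓ_ħ(1)` is multiplication by `ħ n` on the `n`-boson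
sector. -/
def sqrtNumberGraph (d : ℕ) (ħ : ℝ) : Submodule ℂ (Space d × Space d) where
  carrier := {p | ∀ n : ℕ, p.2 n = ((Real.sqrt (ħ * n) : ℝ) : ℂ) • p.1 n}
  zero_mem' := by intro n; simp
  add_mem' := by
    intro p p' hp hp' n
    simp [hp n, hp' n]
  smul_mem' := by
    intro c p hp n
    simp only [Prod.smul_snd, Prod.smul_fst, lp.coeFn_smul, Pi.smul_apply, hp n]
    rw [smul_comm]

lemma sqrtNumberGraph_functional (d : ℕ) (ħ : ℝ) (p : Space d × Space d)
    (hp : p ∈ sqrtNumberGraph d ħ) (h0 : p.1 = 0) : p.2 = 0 := by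
  ext1
  funext n
  rw [hp n, h0]
  simp

/-- The operator `N_ħ^{1/2}`. -/
def sqrtNumber (d : ℕ) (ħ : ℝ) : Space d →ₗ.[ℂ] Space d :=
  (sqrtNumberGraph d ħ).toLinearPMap

/-- The form domain `Q(H_ħ⁰)` of `H_ħ⁰ = |p̂|²/2 + N_ħ`: the intersection of the domains of
`p̂₁, …, p̂_d` and of `N_ħ^{1/2}`. -/
def formDomain (d : ℕ) (ħ : ℝ) : Submodule ℂ (Space d) :=
  (⨅ j : Fin d, (momentum d ħ j).domain) ⊓ (sqrtNumber d ħ).domain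

/-- `p̂ⱼ` restricted to the form domain. -/
def momentumQ (d : ℕ) (ħ : ℝ) (j : Fin d) : formDomain d ħ →ₗ[ℂ] Space d :=
  (momentum d ħ j).toFun ∘ₗ
    Submodule.inclusion (inf_le_left.trans (iInf_le (fun j => (momentum d ħ j).domain) j))

/-- `N_ħ^{1/2}` restricted to the form domain. -/
def sqrtNumberQ (d : ℕ) (ħ : ℝ) : formDomain d ħ →ₗ[ℂ] Space d :=
  (sqrtNumber d ħ).toFun ∘ₗ Submodule.inclusion inf_le_right

/-- The form of the free Hamiltonian,
`⟨φ, H_ħ⁰ ψ⟩ = ½ ∑ⱼ ⟨p̂ⱼ φ, p̂ⱼ ψ⟩ + ⟨N_ħ^{1/2} φ, N_ħ^{1/2} ψ⟩`. -/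
def freeForm (d : ℕ) (ħ : ℝ) : SesqForm (formDomain d ħ) :=
  (1 / 2 : ℂ) • (∑ j : Fin d,
      ((innerₛₗ ℂ).comp (momentumQ d ħ j)).compl₂ (momentumQ d ħ j)) +
    ((innerₛₗ ℂ).comp (sqrtNumberQ d ħ)).compl₂ (sqrtNumberQ d ħ)

/-! ### The interaction -/

/-- The form factor `f^Λ_q(k) = e^{-i k·q} 1_{|k| ≤ Λ} / |k|^{(d-1)/2}`, with `Λ = ∞` allowed. -/
def formFactor (d : ℕ) (Λ : ℝ≥0∞) (q k : Rd d) : ℂ :=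
  {k : Rd d | ‖k‖ₑ ≤ Λ}.indicator
    (fun k => Complex.exp (-Complex.I * (inner ℝ k q : ℝ)) /
      ((‖k‖ ^ (((d : ℝ) - 1) / 2) : ℝ) : ℂ)) k

/-- The annihilation operator:
`(a_ħ(F) ψ)ₙ(q, k₁, …, kₙ) = √(ħ(n+1)) ∫ conj(F_q(k)) ψₙ₊₁(q, k, k₁, …, kₙ) dk`. -/
def annihilate {d : ℕ} (ħ : ℝ) (F : Rd d → Rd d → ℂ) (ψ : Space d) (n : ℕ) (x : Config d n) : ℂ :=
  (Real.sqrt (ħ * (n + 1)) : ℝ) *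
    ∫ k : Rd d, conj (F x.1 k) * wave ψ (n + 1) (x.1, Fin.cons k x.2)

/-- The creation operator `(a_ħ*(F) ψ)ₙ₊₁ = √(ħ(n+1)) Sₙ₊₁ (F ⊗ ψₙ)` (with `Sₙ₊₁` the
symmetrization), that is
`(a_ħ*(F) ψ)ₙ₊₁(q, k₁, …, kₙ₊₁) = √(ħ(n+1)) (n+1)⁻¹ ∑ᵢ F_q(kᵢ) ψₙ(q, k₁, …, k̂ᵢ, …, kₙ₊₁)`,
and `(a_ħ*(F) ψ)₀ = 0`. -/
def create {d : ℕ} (ħ : ℝ) (F : Rd d → Rd d → ℂ) (ψ : Space d) : (n : ℕ) → Config d n → ℂ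
  | 0, _ => 0
  | n + 1, x => (Real.sqrt (ħ * (n + 1)) : ℝ) * ((n + 1 : ℂ)⁻¹ *
      ∑ i : Fin (n + 1), F x.1 (x.2 i) * wave ψ n (x.1, i.removeNth x.2))

/-- The Segal field operator `φ_ħ(F) = (a_ħ(F) + a_ħ*(F)) / √2`. -/
def segalField {d : ℕ} (ħ : ℝ) (F : Rd d → Rd d → ℂ) (ψ : Space d) (n : ℕ) (x : Config d n) : ℂ :=
  (annihilate ħ F ψ n x + create ħ F ψ n x) / (Real.sqrt 2 : ℝ)

/-- The matrix element `⟨φ, φ_ħ(f^Λ_q̂) ψ⟩`. -/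
def interaction (d : ℕ) (ħ : ℝ) (Λ : ℝ≥0∞) (φ ψ : Space d) : ℂ :=
  ∑' n : ℕ, ∫ x : Config d n, conj (wave φ n x) * segalField ħ (formFactor d Λ) ψ n x

/-- The sum and integrals that define `⟨φ, a_ħ(f^∞_q̂) ψ⟩` converge absolutely. -/
def AnnihilationConverges (d : ℕ) (φ ψ : Space d) : Prop :=
  (∑' n : ℕ, ENNReal.ofReal (Real.sqrt (n + 1)) * ∫⁻ x : Config d n, ∫⁻ k : Rd d,
    ‖wave φ n x‖ₑ * ‖formFactor d ⊤ x.1 k‖ₑ * ‖wave ψ (n + 1) (x.1, Fin.cons k x.2)‖ₑ) < ⊤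

end Polaron

end

open Polaron MeasureTheory Filter Topology
open scoped ENNReal NNReal

/-!
The obstruction to `Λ → ∞` is that `f^Λ` is not bounded in `L²`. Following Lieb and Yamazaki,
write `f^∞ = f^Λ + ∑ⱼ kⱼ Gⱼ` with `Gⱼ(k) = 1_{|k| > Λ} kⱼ |k|⁻² |k|^{-(d-1)/2}`. Here `f^Λ` and
`Gⱼ` are in `L²` and `‖Gⱼ‖ → 0` as `Λ → ∞`. Since `q ↦ e^{-ik·q}` is an eigenfunction of `p̂ⱼ`,
the factor `kⱼ` can be traded for a commutator,
`a(kⱼ Gⱼ e^{-ik·q̂}) = ħ⁻¹ [p̂ⱼ, a(Gⱼ e^{-ik·q̂})]`, whose form makes sense on `Q(H_ħ⁰)` and is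
bounded by `‖Gⱼ‖` times the free energy. This gives an infinitesimal form bound and the KLMN
theorem applies.
-/

noncomputable section

open scoped ComplexConjugate ContDiff

namespace Polaron

section DominatedConvergence

variable {α F ι : Type*} [MeasurableSpace α] {μ : Measure α} [NormedAddCommGroup F]

lemma tendsto_toLp_of_dominated_convergence {p : ℝ≥0∞} [Fact (1 ≤ p)] (hp : p ≠ ⊤)
    {l : Filter ι} [l.IsCountablyGenerated] {f : ι → α → F} {g : α → F} {bound : α → ℝ}
    (hf : ∀ i, MemLp (f i) p μ) (hg : MemLp g p μ) (hbound : MemLp bound p μ)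
    (hle : ∀ᶠ i in l, ∀ᵐ x ∂μ, ‖f i x‖ ≤ bound x)
    (hlim : ∀ᵐ x ∂μ, Tendsto (fun i => f i x) l (𝓝 (g x))) :
    Tendsto (fun i => (hf i).toLp (f i)) l (𝓝 (hg.toLp g)) := by
  have hp0 : p ≠ 0 := (zero_lt_one.trans_le Fact.out).ne'
  have hpos : 0 < p.toReal := ENNReal.toReal_pos hp0 hp
  rw [Lp.tendsto_Lp_iff_tendsto_eLpNorm'']
  simp only [eLpNorm_eq_lintegral_rpow_enorm_toReal hp0 hp]
  suffices Tendsto (fun i => ∫⁻ x, ‖(f i - g) x‖ₑ ^ p.toReal ∂μ) l (𝓝 0) by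
    simpa [ENNReal.zero_rpow_of_pos, hpos, Function.comp_def] using
      ((ENNReal.continuous_rpow_const (y := 1 / p.toReal)).tendsto 0).comp this
  have hdom : MemLp (fun x => bound x + ‖g x‖) p μ := hbound.add hg.norm
  rw [← lintegral_zero (μ := μ)]
  refine tendsto_lintegral_filter_of_dominated_convergence'
    (fun x => ‖bound x + ‖g x‖‖ₑ ^ p.toReal)
    (Eventually.of_forall fun i => ((hf i).1.sub hg.1).enorm.pow_const _) ?_
    (lintegral_rpow_enorm_lt_top_of_eLpNorm_lt_top hp0 hp hdom.2).ne ?_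
  · filter_upwards [hle] with i hi
    filter_upwards [hi] with x hx
    gcongr
    rw [enorm_le_iff_norm_le, Pi.sub_apply, Real.norm_eq_abs]
    exact (norm_sub_le _ _).trans ((add_le_add_left hx _).trans (le_abs_self _))
  · filter_upwards [hlim] with x hx
    have hsub := (tendsto_sub_nhds_zero_iff.2 hx).enorm
    rw [enorm_zero] at hsub
    simpa [ENNReal.zero_rpow_of_pos, hpos, Function.comp_def] using
      ((ENNReal.continuous_rpow_const (y := p.toReal)).tendsto 0).comp hsub

end DominatedConvergence

section TestFunctions

variable {E : Type*} [TopologicalSpace E] [MeasurableSpace E] [OpensMeasurableSpace E]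
  {μ : Measure E} [IsFiniteMeasureOnCompacts μ]

lemma exists_clm_eq_integral_smul {g : E → ℝ} (hg : Continuous g) (hc : HasCompactSupport g) :
    ∃ ℓ : Lp ℂ 2 μ →L[ℂ] ℂ, ∀ u : Lp ℂ 2 μ, ℓ u = ∫ x, g x • u x ∂μ := by
  have hm : MemLp (fun x => (g x : ℂ)) 2 μ :=
    (Complex.continuous_ofReal.comp hg).memLp_of_hasCompactSupport
      (hc.comp_left (g := fun r : ℝ => (r : ℂ)) Complex.ofReal_zero)
  refine ⟨innerSL ℂ (hm.toLp _), fun u => ?_⟩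
  rw [innerSL_apply_apply, L2.inner_def]
  refine integral_congr_ae ?_
  filter_upwards [hm.coeFn_toLp] with x hx
  rw [hx, RCLike.inner_apply, Complex.conj_ofReal, Complex.real_smul, mul_comm]

end TestFunctions

section WeakDerivatives

variable {E F : Type*} [NormedAddCommGroup E] [NormedSpace ℝ E] [MeasurableSpace E]
  [NormedAddCommGroup F] [NormedSpace ℝ F] {μ : Measure E}

/-- `w` is the weak derivative of `u` in the direction `v`. -/
def IsWeakLineDeriv (μ : Measure E) (v : E) (u w : E → F) : Prop :=
  ∀ g : E → ℝ, ContDiff ℝ ∞ g → HasCompactSupport g →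
    ∫ x, g x • w x ∂μ = -∫ x, fderiv ℝ g x v • u x ∂μ

lemma IsWeakLineDeriv.congr_ae {u u' w w' : E → F} {v : E} (h : IsWeakLineDeriv μ v u w)
    (hu : u =ᵐ[μ] u') (hw : w =ᵐ[μ] w') : IsWeakLineDeriv μ v u' w' := by
  intro g hg hc
  have hleft : ∫ x, g x • w' x ∂μ = ∫ x, g x • w x ∂μ :=
    integral_congr_ae (hw.symm.mono fun x hx => congrArg (g x • ·) hx)
  have hright : ∫ x, fderiv ℝ g x v • u' x ∂μ = ∫ x, fderiv ℝ g x v • u x ∂μ :=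
    integral_congr_ae (hu.symm.mono fun x hx => congrArg (fderiv ℝ g x v • ·) hx)
  rw [hleft, hright, h g hg hc]

lemma IsWeakLineDeriv.const_smul {𝕜 : Type*} [RCLike 𝕜] [NormedSpace 𝕜 F] [SMulCommClass ℝ 𝕜 F]
    {u w : E → F} {v : E} (c : 𝕜) (h : IsWeakLineDeriv μ v u w) :
    IsWeakLineDeriv μ v (c • u) (c • w) := by
  intro g hg hc
  simp only [Pi.smul_apply, smul_comm _ c, integral_smul, h g hg hc, smul_neg]

variable [BorelSpace E]

lemma isClosed_setOf_isWeakLineDeriv [IsFiniteMeasureOnCompacts μ] (v : E) :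
    IsClosed {p : Lp ℂ 2 μ × Lp ℂ 2 μ | IsWeakLineDeriv μ v p.1 p.2} := by
  simp only [IsWeakLineDeriv, Set.ofPred_forall]
  refine isClosed_iInter fun g => isClosed_iInter fun hg => isClosed_iInter fun hc => ?_
  obtain ⟨ℓ, hℓ⟩ := exists_clm_eq_integral_smul (μ := μ) hg.continuous hc
  obtain ⟨ℓ', hℓ'⟩ := exists_clm_eq_integral_smul (μ := μ)
    ((hg.continuous_fderiv (by simp)).clm_apply (continuous_const (y := v)))
    (hc.fderiv_apply (𝕜 := ℝ) v)
  simp only [← hℓ, ← hℓ']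
  exact isClosed_eq (by fun_prop) (by fun_prop)

lemma isWeakLineDeriv_fderiv [FiniteDimensional ℝ E] [μ.IsAddHaarMeasure] {f : E → F}
    (hf : ContDiff ℝ 1 f) (v : E) : IsWeakLineDeriv μ v f fun x => fderiv ℝ f x v := by
  intro g hg hc
  have hg' : Continuous fun x => fderiv ℝ g x v :=
    (hg.continuous_fderiv (by simp)).clm_apply continuous_const
  have hf' : Continuous fun x => fderiv ℝ f x v :=
    (hf.continuous_fderiv one_ne_zero).clm_apply continuous_const
  exact integral_smul_fderiv_eq_neg_fderiv_smul_of_integrable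
    ((hg'.smul hf.continuous).integrable_of_hasCompactSupport
      (hc.fderiv_apply (𝕜 := ℝ) v).smul_right)
    ((hg.continuous.smul hf').integrable_of_hasCompactSupport hc.smul_right)
    ((hg.continuous.smul hf.continuous).integrable_of_hasCompactSupport hc.smul_right)
    (fun x _ => hg.differentiable (by simp) x) (fun x _ => hf.differentiable one_ne_zero x)

end WeakDerivatives

section Translation

variable {E F : Type*} [NormedAddCommGroup E] [MeasurableSpace E] [BorelSpace E]
  [NormedAddCommGroup F] {μ : Measure E} [μ.IsAddHaarMeasure]

/-- The translation `u ↦ u (v + ·)` on `L²`. -/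
def translate (μ : Measure E) [μ.IsAddHaarMeasure] (v : E) : Lp ℂ 2 μ →ₗᵢ[ℂ] Lp ℂ 2 μ :=
  Lp.compMeasurePreservingₗᵢ ℂ (v + ·) (measurePreserving_add_left μ v)

lemma coeFn_translate (v : E) (u : Lp ℂ 2 μ) : translate μ v u =ᵐ[μ] fun x => u (v + x) :=
  Lp.coeFn_compMeasurePreserving u (measurePreserving_add_left μ v)

lemma translate_zero (u : Lp ℂ 2 μ) : translate μ 0 u = u := by
  apply Lp.ext
  filter_upwards [coeFn_translate 0 u] with x hx
  rw [hx, zero_add]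

lemma integral_smul_translate (g : E → ℝ) (v : E) (u : Lp ℂ 2 μ) :
    ∫ x, g x • translate μ v u x ∂μ = ∫ x, g (x - v) • u x ∂μ := by
  rw [← integral_add_left_eq_self (fun x => g (x - v) • u x) v]
  refine integral_congr_ae ?_
  filter_upwards [coeFn_translate v u] with x hx
  rw [hx, add_sub_cancel_left]

variable [NormedSpace ℝ E]

/-- Integration by parts, from the translation invariance of the inner product. -/
lemma inner_add_inner_eq_zero_of_hasDerivAt_translate {u u' w w' : Lp ℂ 2 μ} {v : E}
    (hu : HasDerivAt (fun t : ℝ => translate μ (t • v) u) u' 0)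
    (hw : HasDerivAt (fun t : ℝ => translate μ (t • v) w) w' 0) :
    inner ℂ u' w + inner ℂ u w' = 0 := by
  have h := hu.inner ℂ hw
  simp only [LinearIsometry.inner_map_map, zero_smul, translate_zero] at h
  rw [add_comm]
  exact h.unique (hasDerivAt_const _ _)

variable [FiniteDimensional ℝ E]

lemma continuous_translate_smul (v : E) (u : Lp ℂ 2 μ) :
    Continuous fun t : ℝ => translate μ (t • v) u := by
  have : Fact ((2 : ℝ≥0∞) ≠ ⊤) := ⟨by norm_num⟩
  have hmk : Continuous fun t : ℝ => DomAddAct.mk (t • v) :=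
    DomAddAct.continuous_mk.comp (by fun_prop)
  exact hmk.vadd (continuous_const (y := u))

lemma Lp_ext_of_integral_contDiff_smul {u w : Lp ℂ 2 μ}
    (h : ∀ g : E → ℝ, ContDiff ℝ ∞ g → HasCompactSupport g →
      ∫ x, g x • u x ∂μ = ∫ x, g x • w x ∂μ) : u = w :=
  Lp.ext <| ae_eq_of_integral_contDiff_smul_eq ((Lp.memLp u).locallyIntegrable (by norm_num))
    ((Lp.memLp w).locallyIntegrable (by norm_num)) h

variable [NormedSpace ℝ F]

-- The integral is a convolution with the reflection of `g`, evaluated along the line `ℝ v`.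
lemma hasDerivAt_integral_comp_sub_smul {f : E → F} (hf : LocallyIntegrable f μ) {g : E → ℝ}
    (hg : ContDiff ℝ 1 g) (hc : HasCompactSupport g) (v : E) (t : ℝ) :
    HasDerivAt (fun t : ℝ => ∫ x, g (x - t • v) • f x ∂μ)
      (-∫ x, fderiv ℝ g (x - t • v) v • f x ∂μ) t := by
  set L : F →L[ℝ] ℝ →L[ℝ] F := (ContinuousLinearMap.lsmul ℝ ℝ).flip
  have hgneg : ContDiff ℝ 1 fun x => g (-x) := hg.comp contDiff_neg
  have hcneg : HasCompactSupport fun x => g (-x) := hc.comp_homeomorph (Homeomorph.neg E)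
  have hline : HasDerivAt (fun s : ℝ => s • v) v t := by
    simpa using (hasDerivAt_id t).smul_const v
  have hconv := (hcneg.hasFDerivAt_convolution_right (μ := μ) L hf hgneg
    (t • v)).comp_hasDerivAt t hline
  rw [convolution_precompR_apply L hf (hcneg.fderiv (𝕜 := ℝ))
    (hgneg.continuous_fderiv one_ne_zero) (t • v) v] at hconv
  have hderiv_neg (y : E) : fderiv ℝ (fun x => g (-x)) y = -fderiv ℝ g (-y) := by
    simpa using fderiv_comp_smul (𝕜 := ℝ) (f := g) (x := y) (-1 : ℝ)
  convert hconv using 1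
  · funext s
    simp [convolution_def, L]
  · simp [convolution_def, L, hderiv_neg, integral_neg]

lemma IsWeakLineDeriv.hasDerivAt_integral_smul_translate {u w : Lp ℂ 2 μ} {v : E}
    (h : IsWeakLineDeriv μ v u w) {g : E → ℝ} (hg : ContDiff ℝ ∞ g) (hc : HasCompactSupport g)
    (t : ℝ) :
    HasDerivAt (fun t : ℝ => ∫ x, g x • translate μ (t • v) u x ∂μ)
      (∫ x, g x • translate μ (t • v) w x ∂μ) t := by
  have hshift : HasCompactSupport fun x => g (x - t • v) := by
    simpa [sub_eq_add_neg, Function.comp_def] using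
      hc.comp_homeomorph (Homeomorph.addRight (-(t • v)))
  have hweak := h _ (hg.comp (contDiff_id.sub contDiff_const)) hshift
  simp only [id_eq, fderiv_comp_sub, Function.comp_def] at hweak
  simp only [integral_smul_translate, hweak]
  exact hasDerivAt_integral_comp_sub_smul ((Lp.memLp u).locallyIntegrable (by norm_num))
    (hg.of_le (by simp)) hc v t

lemma IsWeakLineDeriv.translate_eq_add_integral {u w : Lp ℂ 2 μ} {v : E}
    (h : IsWeakLineDeriv μ v u w) (t : ℝ) :
    translate μ (t • v) u = u + ∫ s in (0 : ℝ)..t, translate μ (s • v) w := by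
  have hcont := continuous_translate_smul (μ := μ) v w
  refine Lp_ext_of_integral_contDiff_smul fun g hg hc => ?_
  obtain ⟨ℓ, hℓ⟩ := exists_clm_eq_integral_smul (μ := μ) hg.continuous hc
  have hderiv : ∀ s ∈ Set.uIcc 0 t,
      HasDerivAt (fun s : ℝ => ℓ (translate μ (s • v) u)) (ℓ (translate μ (s • v) w)) s := by
    intro s _
    simp only [hℓ]
    exact h.hasDerivAt_integral_smul_translate hg hc s
  rw [← hℓ, ← hℓ, map_add, ← ℓ.intervalIntegral_comp_comm (hcont.intervalIntegrable 0 t),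
    intervalIntegral.integral_eq_sub_of_hasDerivAt hderiv
      ((ℓ.continuous.comp hcont).intervalIntegrable 0 t), zero_smul, translate_zero]
  ring

lemma IsWeakLineDeriv.hasDerivAt_translate {u w : Lp ℂ 2 μ} {v : E}
    (h : IsWeakLineDeriv μ v u w) :
    HasDerivAt (fun t : ℝ => translate μ (t • v) u) w 0 := by
  have hcont := continuous_translate_smul (μ := μ) v w
  have hinteg := intervalIntegral.integral_hasDerivAt_right (hcont.intervalIntegrable 0 0)
    (hcont.stronglyMeasurableAtFilter _ _) hcont.continuousAt
  rw [zero_smul, translate_zero] at hinteg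
  simp_rw [h.translate_eq_add_integral]
  exact hinteg.const_add u

end Translation

local notation "L²(" E ")" => Lp ℂ 2 (volume : Measure E)

section Tensor

variable {d n : ℕ}

instance isAddHaarMeasure_volume_config (d n : ℕ) :
    (volume : Measure (Config d n)).IsAddHaarMeasure := by
  have : (volume : Measure (Fin n → Rd d)).IsAddHaarMeasure := by
    rw [volume_pi]
    infer_instance
  rw [Measure.volume_eq_prod]
  infer_instance

/-- The separation of the first boson, `(q, k₁, …, kₙ₊₁) ↦ ((q, k₂, …, kₙ₊₁), k₁)`. -/
def splitFirst (d n : ℕ) : Config d (n + 1) ≃ᵐ Config d n × Rd d :=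
  (MeasurableEquiv.prodCongr (MeasurableEquiv.refl (Rd d))
    ((MeasurableEquiv.piFinSuccAbove (fun _ : Fin (n + 1) => Rd d) 0).trans
      MeasurableEquiv.prodComm)).trans MeasurableEquiv.prodAssoc.symm

lemma splitFirst_apply (y : Config d (n + 1)) :
    splitFirst d n y = ((y.1, Fin.tail y.2), y.2 0) := rfl

lemma splitFirst_symm_apply (x : Config d n) (k : Rd d) :
    (splitFirst d n).symm (x, k) = (x.1, Fin.cons k x.2) := by
  rw [MeasurableEquiv.symm_apply_eq, splitFirst_apply]
  simp

lemma measurePreserving_splitFirst : MeasurePreserving (splitFirst d n) volume volume := by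
  have hhead := volume_preserving_piFinSuccAbove (fun _ : Fin (n + 1) => Rd d) 0
  have hswap : MeasurePreserving (Prod.swap : Rd d × (Fin n → Rd d) → _) volume volume :=
    Measure.measurePreserving_swap
  have hassoc := (measurePreserving_prodAssoc (volume : Measure (Rd d))
    (volume : Measure (Fin n → Rd d)) (volume : Measure (Rd d))).symm
  exact hassoc.comp ((MeasurePreserving.id (volume : Measure (Rd d))).prod (hswap.comp hhead))

lemma quasiMeasurePreserving_tail :
    Measure.QuasiMeasurePreserving (fun y : Config d (n + 1) => ((y.1, Fin.tail y.2) : Config d n))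
      volume volume :=
  Measure.quasiMeasurePreserving_fst.comp measurePreserving_splitFirst.quasiMeasurePreserving

lemma quasiMeasurePreserving_head :
    Measure.QuasiMeasurePreserving (fun y : Config d (n + 1) => y.2 0) volume volume :=
  Measure.quasiMeasurePreserving_snd.comp measurePreserving_splitFirst.quasiMeasurePreserving

/-- The plane wave `e^{-i k·q}`. -/
def planeWave (q k : Rd d) : ℂ := Complex.exp (-Complex.I * (inner ℝ k q : ℝ))

lemma norm_planeWave (q k : Rd d) : ‖planeWave q k‖ = 1 := by
  rw [planeWave, Complex.norm_exp]
  simp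

lemma planeWave_add (q q' k : Rd d) : planeWave (q + q') k = planeWave q k * planeWave q' k := by
  simp only [planeWave, ← Complex.exp_add, inner_add_right]
  push_cast
  ring_nf

lemma planeWave_smul (t : ℝ) (q k : Rd d) :
    planeWave (t • q) k = Complex.exp (Complex.I * ((-(t * inner ℝ k q) : ℝ) : ℂ)) := by
  rw [planeWave, inner_smul_right]
  push_cast
  ring_nf

lemma continuous_planeWave : Continuous fun p : Rd d × Rd d => planeWave p.1 p.2 := by
  unfold planeWave
  fun_prop

/-- The function `(q, k, k₁, …, kₙ) ↦ e^{-i k·q} h(k) u(q, k₁, …, kₙ)`. Before symmetrization, the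
creation operator with form factor `e^{-i k·q} h(k)` maps `u` to a multiple of it. -/
def tensorFun (h : Rd d → ℂ) (u : Config d n → ℂ) (y : Config d (n + 1)) : ℂ :=
  planeWave y.1 (y.2 0) * h (y.2 0) * u (y.1, Fin.tail y.2)

lemma tensorFun_congr_ae {h h' : Rd d → ℂ} {u u' : Config d n → ℂ} (hh : h =ᵐ[volume] h')
    (hu : u =ᵐ[volume] u') : tensorFun h u =ᵐ[volume] tensorFun h' u' := by
  filter_upwards [quasiMeasurePreserving_head.ae hh, quasiMeasurePreserving_tail.ae hu]
    with y hhead htail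
  simp only [tensorFun, hhead, htail]

lemma aestronglyMeasurable_tensorFun {h : Rd d → ℂ} {u : Config d n → ℂ}
    (hh : AEStronglyMeasurable h volume) (hu : AEStronglyMeasurable u volume) :
    AEStronglyMeasurable (tensorFun h u) volume := by
  refine AEStronglyMeasurable.mul (AEStronglyMeasurable.mul ?_ ?_) ?_
  · exact (continuous_planeWave.comp (f := fun y : Config d (n + 1) => (y.1, y.2 0))
      (by fun_prop)).aestronglyMeasurable
  · exact hh.comp_quasiMeasurePreserving quasiMeasurePreserving_head
  · exact hu.comp_quasiMeasurePreserving quasiMeasurePreserving_tail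

lemma enorm_tensorFun (h : Rd d → ℂ) (u : Config d n → ℂ) (y : Config d (n + 1)) :
    ‖tensorFun h u y‖ₑ = ‖u (y.1, Fin.tail y.2)‖ₑ * ‖h (y.2 0)‖ₑ := by
  have hwave : ‖planeWave y.1 (y.2 0)‖ₑ = 1 := by
    rw [← ofReal_norm, norm_planeWave, ENNReal.ofReal_one]
  rw [tensorFun, enorm_mul, enorm_mul, hwave, one_mul, mul_comm]

lemma eLpNorm_tensorFun {h : Rd d → ℂ} {u : Config d n → ℂ}
    (hh : AEStronglyMeasurable h volume) (hu : AEStronglyMeasurable u volume) :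
    eLpNorm (tensorFun h u) 2 volume = eLpNorm h 2 volume * eLpNorm u 2 volume := by
  have hsplit := measurePreserving_splitFirst.lintegral_comp_emb
    (splitFirst d n).measurableEmbedding
    (fun p => ‖u p.1‖ₑ ^ (2 : ℝ≥0∞).toReal * ‖h p.2‖ₑ ^ (2 : ℝ≥0∞).toReal)
  rw [Measure.volume_eq_prod (Config d n),
    lintegral_prod_mul (hu.enorm.pow_const _) (hh.enorm.pow_const _)] at hsplit
  simp only [splitFirst_apply] at hsplit
  simp only [eLpNorm_eq_lintegral_rpow_enorm_toReal two_ne_zero ENNReal.ofNat_ne_top,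
    enorm_tensorFun, ENNReal.mul_rpow_of_nonneg _ _ ENNReal.toReal_nonneg]
  rw [hsplit, ENNReal.mul_rpow_of_nonneg _ _ (by positivity), mul_comm]

lemma memLp_tensorFun (h : L²(Rd d)) (u : L²(Config d n)) : MemLp (tensorFun h u) 2 volume := by
  refine ⟨aestronglyMeasurable_tensorFun (Lp.aestronglyMeasurable h)
    (Lp.aestronglyMeasurable u), ?_⟩
  rw [eLpNorm_tensorFun (Lp.aestronglyMeasurable h) (Lp.aestronglyMeasurable u)]
  exact ENNReal.mul_lt_top (Lp.memLp h).2 (Lp.memLp u).2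

/-- `tensorFun` as a bounded bilinear map on `L²`. -/
def tensor (d n : ℕ) : L²(Rd d) →L[ℂ] L²(Config d n) →L[ℂ] L²(Config d (n + 1)) :=
  LinearMap.mkContinuous₂
    (LinearMap.mk₂ ℂ (fun h u => (memLp_tensorFun h u).toLp _)
      (fun h h' u => by
        rw [← MemLp.toLp_add, MemLp.toLp_eq_toLp_iff]
        refine (tensorFun_congr_ae (Lp.coeFn_add h h') EventuallyEq.rfl).trans (.of_eq ?_)
        funext y; simp only [tensorFun, Pi.add_apply]; ring)
      (fun c h u => by
        rw [← MemLp.toLp_const_smul, MemLp.toLp_eq_toLp_iff]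
        refine (tensorFun_congr_ae (Lp.coeFn_smul c h) EventuallyEq.rfl).trans (.of_eq ?_)
        funext y; simp only [tensorFun, Pi.smul_apply, smul_eq_mul]; ring)
      (fun h u u' => by
        rw [← MemLp.toLp_add, MemLp.toLp_eq_toLp_iff]
        refine (tensorFun_congr_ae EventuallyEq.rfl (Lp.coeFn_add u u')).trans (.of_eq ?_)
        funext y; simp only [tensorFun, Pi.add_apply]; ring)
      (fun c h u => by
        rw [← MemLp.toLp_const_smul, MemLp.toLp_eq_toLp_iff]
        refine (tensorFun_congr_ae EventuallyEq.rfl (Lp.coeFn_smul c u)).trans (.of_eq ?_)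
        funext y; simp only [tensorFun, Pi.smul_apply, smul_eq_mul]; ring))
    1 (fun h u => by
      rw [LinearMap.mk₂_apply, Lp.norm_toLp, one_mul,
        eLpNorm_tensorFun (Lp.aestronglyMeasurable h) (Lp.aestronglyMeasurable u),
        ENNReal.toReal_mul, Lp.norm_def, Lp.norm_def])

lemma coeFn_tensor (h : L²(Rd d)) (u : L²(Config d n)) : tensor d n h u =ᵐ[volume] tensorFun h u :=
  (memLp_tensorFun h u).coeFn_toLp

lemma norm_tensor (h : L²(Rd d)) (u : L²(Config d n)) : ‖tensor d n h u‖ = ‖h‖ * ‖u‖ := by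
  rw [Lp.norm_def, eLpNorm_congr_ae (coeFn_tensor h u),
    eLpNorm_tensorFun (Lp.aestronglyMeasurable h) (Lp.aestronglyMeasurable u),
    ENNReal.toReal_mul, Lp.norm_def, Lp.norm_def]

end Tensor

section Commutator

variable {d n : ℕ}

lemma memLp_planeWave_mul (q : Rd d) (h : L²(Rd d)) :
    MemLp (fun k => planeWave q k * h k) 2 volume :=
  (Lp.memLp h).congr_norm
    ((continuous_planeWave.comp (Continuous.prodMk_right q)).aestronglyMeasurable.mul
      (Lp.aestronglyMeasurable h))
    (Eventually.of_forall fun k => by rw [norm_mul, norm_planeWave, one_mul])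

/-- Multiplication by the plane wave `k ↦ e^{-i k·q}`: a translation of the particle by `q` acts
in this way on the form factor. -/
def modulate (q : Rd d) (h : L²(Rd d)) : L²(Rd d) := (memLp_planeWave_mul q h).toLp _

lemma coeFn_modulate (q : Rd d) (h : L²(Rd d)) :
    modulate q h =ᵐ[volume] fun k => planeWave q k * h k :=
  (memLp_planeWave_mul q h).coeFn_toLp

lemma modulate_zero (h : L²(Rd d)) : modulate 0 h = h := by
  apply Lp.ext
  filter_upwards [coeFn_modulate 0 h] with k hk
  simp [hk, planeWave]

lemma translate_tensor (q : Rd d) (h : L²(Rd d)) (u : L²(Config d n)) :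
    translate volume (q, 0) (tensor d n h u)
      = tensor d n (modulate q h) (translate volume (q, 0) u) := by
  apply Lp.ext
  have hshift := (measurePreserving_add_left (volume : Measure (Config d (n + 1)))
    (q, 0)).quasiMeasurePreserving.ae (coeFn_tensor h u)
  filter_upwards [coeFn_translate (q, 0) (tensor d n h u), hshift,
    coeFn_tensor (modulate q h) (translate volume (q, 0) u),
    tensorFun_congr_ae (coeFn_modulate q h) (coeFn_translate (q, 0) u)]
    with y hleft htensor hright hmod
  rw [hleft, htensor, hright, hmod]
  simp only [tensorFun, Prod.fst_add, Prod.snd_add, zero_add, planeWave_add, Prod.mk_add_mk]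
  ring

lemma norm_slope_planeWave_le (t : ℝ) (q k : Rd d) :
    ‖(t : ℂ)⁻¹ * (planeWave (t • q) k - 1)‖ ≤ |inner ℝ k q| := by
  rcases eq_or_ne t 0 with rfl | ht
  · simp
  have hexp := Real.norm_exp_I_mul_ofReal_sub_one_le (x := -(t * inner ℝ k q))
  rw [← planeWave_smul, norm_neg, norm_mul, Real.norm_eq_abs, Real.norm_eq_abs] at hexp
  rw [norm_mul, norm_inv, Complex.norm_real, Real.norm_eq_abs]
  exact (inv_mul_le_iff₀ (abs_pos.2 ht)).2 hexp

lemma hasDerivAt_planeWave_smul (q k : Rd d) :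
    HasDerivAt (fun t : ℝ => planeWave (t • q) k) (-Complex.I * (inner ℝ k q : ℝ)) 0 := by
  simp only [planeWave_smul]
  have hlin : HasDerivAt (fun t : ℝ => Complex.I * ((-(t * inner ℝ k q) : ℝ) : ℂ))
      (Complex.I * ((-(1 * inner ℝ k q) : ℝ) : ℂ)) 0 :=
    (((hasDerivAt_id (0 : ℝ)).mul_const _).neg.ofReal_comp).const_mul _
  simpa using hlin.cexp

lemma hasDerivAt_modulate (q : Rd d) {h kh : L²(Rd d)}
    (hkh : kh =ᵐ[volume] fun k => (inner ℝ k q : ℂ) * h k) :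
    HasDerivAt (fun t : ℝ => modulate (t • q) h) (-Complex.I • kh) 0 := by
  rw [hasDerivAt_iff_tendsto_slope_zero]
  let slope (t : ℝ) : Rd d → ℂ := t⁻¹ • ((fun k => planeWave (t • q) k * h k) - h)
  have hslope (t : ℝ) : MemLp (slope t) 2 volume :=
    ((memLp_planeWave_mul (t • q) h).sub (Lp.memLp h)).const_smul t⁻¹
  have hslope_eq (t : ℝ) (k : Rd d) :
      slope t k = (t : ℂ)⁻¹ * (planeWave (t • q) k - 1) * h k := by
    simp only [slope, Pi.smul_apply, Pi.sub_apply, Complex.real_smul, Complex.ofReal_inv]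
    ring
  have hlim : ∀ᵐ k : Rd d, Tendsto (fun t => slope t k) (𝓝[≠] 0)
      (𝓝 ((-Complex.I • (kh : Rd d → ℂ)) k)) := by
    filter_upwards [hkh] with k hk
    have hderiv := (hasDerivAt_iff_tendsto_slope_zero.1 (hasDerivAt_planeWave_smul q k)).mul_const
      (h k)
    simpa [hslope_eq, hk, planeWave, mul_assoc] using hderiv
  have hdom := tendsto_toLp_of_dominated_convergence ENNReal.ofNat_ne_top hslope
    ((Lp.memLp kh).const_smul (-Complex.I)) (Lp.memLp kh).norm (Eventually.of_forall fun t => by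
      filter_upwards [hkh] with k hk
      rw [hslope_eq, hk, norm_mul _ (h k), norm_mul _ (h k), Complex.norm_real, Real.norm_eq_abs]
      gcongr
      exact norm_slope_planeWave_le t q k) hlim
  rw [MemLp.toLp_const_smul _ (Lp.memLp kh), Lp.toLp_coeFn] at hdom
  refine hdom.congr fun t => ?_
  rw [zero_add, zero_smul, modulate_zero, modulate,
    MemLp.toLp_const_smul _ ((memLp_planeWave_mul (t • q) h).sub (Lp.memLp h)),
    MemLp.toLp_sub _ (Lp.memLp h), Lp.toLp_coeFn]

lemma hasDerivAt_translate_tensor (q : Rd d) {h kh : L²(Rd d)}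
    (hkh : kh =ᵐ[volume] fun k => (inner ℝ k q : ℂ) * h k) {u u' : L²(Config d n)}
    (hu : HasDerivAt (fun t : ℝ => translate volume (t • ((q, 0) : Config d n)) u) u' 0) :
    HasDerivAt (fun t : ℝ => translate volume (t • ((q, 0) : Config d (n + 1))) (tensor d n h u))
      (tensor d n h u' - Complex.I • tensor d n kh u) 0 := by
  have hbilin := ((tensor d n).bilinearRestrictScalars ℝ).hasDerivAt_of_bilinear
    (fun _ => hasDerivAt_modulate q hkh) (fun _ => hu)
  simp only [ContinuousLinearMap.bilinearRestrictScalars_apply_apply, modulate_zero, zero_smul,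
    translate_zero] at hbilin
  have htranslate (t : ℝ) : translate volume (t • ((q, 0) : Config d (n + 1))) (tensor d n h u)
      = tensor d n (modulate (t • q) h) (translate volume (t • ((q, 0) : Config d n)) u) := by
    simpa only [Prod.smul_mk, smul_zero] using translate_tensor (t • q) h u
  have hcomm : tensor d n (-Complex.I • kh) u = -(Complex.I • tensor d n kh u) := by
    rw [map_smul, neg_smul]
    rfl
  simp only [htranslate]
  rw [sub_eq_add_neg, ← hcomm]
  exact hbilin

/-- The commutator of the interaction with the particle momentum in the direction `q`. -/
lemma inner_tensor_mul_eq_neg_add (q : Rd d) {h kh : L²(Rd d)}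
    (hkh : kh =ᵐ[volume] fun k => (inner ℝ k q : ℂ) * h k)
    {u u' : L²(Config d n)} {v v' : L²(Config d (n + 1))}
    (hu : HasDerivAt (fun t : ℝ => translate volume (t • ((q, 0) : Config d n)) u) u' 0)
    (hv : HasDerivAt (fun t : ℝ => translate volume (t • ((q, 0) : Config d (n + 1))) v) v' 0) :
    Complex.I * inner ℂ (tensor d n kh u) v
      = -(inner ℂ (tensor d n h u') v + inner ℂ (tensor d n h u) v') := by
  have hparts :=
    inner_add_inner_eq_zero_of_hasDerivAt_translate (hasDerivAt_translate_tensor q hkh hu) hv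
  rw [inner_sub_left, inner_smul_left, Complex.conj_I] at hparts
  linear_combination hparts

end Commutator

section Forms

open scoped ComplexOrder

variable {H : Type*} [NormedAddCommGroup H] [InnerProductSpace ℂ H] {Q : Submodule ℂ H}

lemma IsHermitianForm.add {h h' : SesqForm Q} (hh : IsHermitianForm h) (hh' : IsHermitianForm h') :
    IsHermitianForm (h + h') := by
  intro φ ψ
  simp only [LinearMap.add_apply, map_add, hh φ ψ, hh' φ ψ]

section RelativelyBounded

variable {h₀ w : SesqForm Q} {a C : ℝ}

lemma one_sub_mul_re_sub_le_re_add_self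
    (hw : ∀ ψ : Q, ‖w ψ ψ‖ ≤ a * (h₀ ψ ψ).re + C * ‖(ψ : H)‖ ^ 2) (ψ : Q) :
    (1 - a) * (h₀ ψ ψ).re - C * ‖(ψ : H)‖ ^ 2 ≤ ((h₀ + w) ψ ψ).re := by
  have hre := (abs_le.1 ((Complex.abs_re_le_norm (w ψ ψ)).trans (hw ψ))).1
  simp only [LinearMap.add_apply, Complex.add_re]
  linarith

lemma isBoundedBelowForm_add_of_norm_le (ha : a ≤ 1) (hpos : ∀ ψ, 0 ≤ h₀ ψ ψ)
    (hw : ∀ ψ : Q, ‖w ψ ψ‖ ≤ a * (h₀ ψ ψ).re + C * ‖(ψ : H)‖ ^ 2) :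
    IsBoundedBelowForm (h₀ + w) := by
  refine ⟨-C, fun ψ => ?_⟩
  have hnonneg := mul_nonneg (sub_nonneg.2 ha) (Complex.nonneg_iff.1 (hpos ψ)).1
  linarith [one_sub_mul_re_sub_le_re_add_self hw ψ]

variable {ι : Type*} {l : Filter ι} {ψ : ι → Q}

lemma tendsto_self_of_tendsto_add_self (ha : a < 1) (hpos : ∀ ψ, 0 ≤ h₀ ψ ψ)
    (hw : ∀ ψ : Q, ‖w ψ ψ‖ ≤ a * (h₀ ψ ψ).re + C * ‖(ψ : H)‖ ^ 2)
    (hψ : Tendsto (fun i => ‖(ψ i : H)‖) l (𝓝 0))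
    (hadd : Tendsto (fun i => (h₀ + w) (ψ i) (ψ i)) l (𝓝 0)) :
    Tendsto (fun i => h₀ (ψ i) (ψ i)) l (𝓝 0) := by
  have ha' : 0 < 1 - a := sub_pos.2 ha
  have hlim : Tendsto (fun i => (1 - a)⁻¹ *
      (‖(h₀ + w) (ψ i) (ψ i)‖ + C * ‖(ψ i : H)‖ ^ 2)) l (𝓝 0) := by
    simpa using (hadd.norm.add ((hψ.pow 2).const_mul C)).const_mul (1 - a)⁻¹
  refine squeeze_zero_norm (fun i => ?_) hlim
  have hnorm : ‖h₀ (ψ i) (ψ i)‖ = (h₀ (ψ i) (ψ i)).re := by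
    exact_mod_cast congrArg Complex.re (Complex.norm_of_nonneg' (hpos (ψ i)))
  rw [hnorm, ← div_eq_inv_mul, le_div_iff₀ ha']
  linarith [one_sub_mul_re_sub_le_re_add_self hw (ψ i), Complex.re_le_norm ((h₀ + w) (ψ i) (ψ i))]

lemma tendsto_add_self_of_tendsto_self
    (hw : ∀ ψ : Q, ‖w ψ ψ‖ ≤ a * (h₀ ψ ψ).re + C * ‖(ψ : H)‖ ^ 2)
    (hψ : Tendsto (fun i => ‖(ψ i : H)‖) l (𝓝 0))
    (hself : Tendsto (fun i => h₀ (ψ i) (ψ i)) l (𝓝 0)) :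
    Tendsto (fun i => (h₀ + w) (ψ i) (ψ i)) l (𝓝 0) := by
  have hbound : Tendsto (fun i => a * (h₀ (ψ i) (ψ i)).re + C * ‖(ψ i : H)‖ ^ 2) l (𝓝 0) := by
    have hre : Tendsto (fun i => (h₀ (ψ i) (ψ i)).re) l (𝓝 0) :=
      (Complex.continuous_re.tendsto 0).comp hself
    simpa using (hre.const_mul a).add ((hψ.pow 2).const_mul C)
  simpa using hself.add (squeeze_zero_norm (fun i => hw (ψ i)) hbound)

lemma isClosedForm_add_of_norm_le (ha : a < 1) (hpos : ∀ ψ, 0 ≤ h₀ ψ ψ)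
    (hw : ∀ ψ : Q, ‖w ψ ψ‖ ≤ a * (h₀ ψ ψ).re + C * ‖(ψ : H)‖ ^ 2) (hclosed : IsClosedForm h₀) :
    IsClosedForm (h₀ + w) := by
  intro u x hu hform
  have hcauchy : Tendsto (fun p : ℕ × ℕ => ‖((u p.1 - u p.2 : Q) : H)‖) atTop (𝓝 0) := by
    have hdiff : Tendsto (fun p : ℕ × ℕ => (u p.1 : H) - u p.2) atTop (𝓝 (x - x)) := by
      rw [← prod_atTop_atTop_eq]
      exact (hu.comp tendsto_fst).sub (hu.comp tendsto_snd)
    simpa using hdiff.norm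
  obtain ⟨y, rfl, hy⟩ :=
    hclosed u x hu (tendsto_self_of_tendsto_add_self ha hpos hw hcauchy hform)
  refine ⟨y, rfl, tendsto_add_self_of_tendsto_self hw ?_ hy⟩
  simpa using (hu.sub_const (y : H)).norm

lemma IsInfinitesimallyFormBounded.isBoundedBelowForm_add (hw : IsInfinitesimallyFormBounded w h₀)
    (hpos : ∀ ψ, 0 ≤ h₀ ψ ψ) : IsBoundedBelowForm (h₀ + w) := by
  obtain ⟨C, hC⟩ := hw (1 / 2) one_half_pos
  exact isBoundedBelowForm_add_of_norm_le one_half_lt_one.le hpos hC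

lemma IsInfinitesimallyFormBounded.isClosedForm_add (hw : IsInfinitesimallyFormBounded w h₀)
    (hpos : ∀ ψ, 0 ≤ h₀ ψ ψ) (hclosed : IsClosedForm h₀) : IsClosedForm (h₀ + w) := by
  obtain ⟨C, hC⟩ := hw (1 / 2) one_half_pos
  exact isClosedForm_add_of_norm_le one_half_lt_one hpos hC hclosed

end RelativelyBounded

lemma isClosedForm_of_eq_sum_sq_norm {ι H' : Type*} [Fintype ι] [NormedAddCommGroup H']
    [InnerProductSpace ℂ H'] [CompleteSpace H'] {h : SesqForm Q} {T : ι → H →ₗ.[ℂ] H'}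
    {TQ : ι → Q →ₗ[ℂ] H'} {c : ι → ℝ} (hc : ∀ i, 0 < c i) (hT : ∀ i, (T i).IsClosed)
    (hTQ : ∀ i (ψ : Q), ((ψ : H), TQ i ψ) ∈ (T i).graph)
    (hQ : ∀ x, (∀ i, x ∈ (T i).domain) → x ∈ Q)
    (hself : ∀ ψ, h ψ ψ = ((∑ i, c i * ‖TQ i ψ‖ ^ 2 : ℝ) : ℂ)) : IsClosedForm h := by
  intro u x hu hform
  have hsum : Tendsto (fun p : ℕ × ℕ => ∑ i, c i * ‖TQ i (u p.1 - u p.2)‖ ^ 2) atTop (𝓝 0) := by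
    refine ((Complex.continuous_re.tendsto 0).comp hform).congr fun p => ?_
    rw [Function.comp_apply, hself, Complex.ofReal_re]
  have hcauchy (i : ι) : CauchySeq fun k => TQ i (u k) := by
    have hsq := squeeze_zero (fun p => mul_nonneg (hc i).le (sq_nonneg _))
      (fun p : ℕ × ℕ => Finset.single_le_sum (f := fun i => c i * ‖TQ i (u p.1 - u p.2)‖ ^ 2)
        (fun j _ => mul_nonneg (hc j).le (sq_nonneg _)) (Finset.mem_univ i)) hsum
    rw [cauchySeq_iff_tendsto_dist_atTop_0]
    simpa [(hc i).ne', dist_eq_norm] using (hsq.const_mul (c i)⁻¹).sqrt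
  choose y hy using fun i => cauchySeq_tendsto_of_complete (hcauchy i)
  have hgraph (i : ι) : (x, y i) ∈ (T i).graph :=
    IsClosed.mem_of_tendsto (hT i) (hu.prodMk_nhds (hy i))
      (Eventually.of_forall fun k => hTQ i (u k))
  have hxQ : x ∈ Q := hQ x fun i => LinearPMap.mem_domain_of_mem_graph (hgraph i)
  have hTx (i : ι) : TQ i ⟨x, hxQ⟩ = y i :=
    (T i).mem_graph_snd_inj (hTQ i ⟨x, hxQ⟩) (hgraph i) rfl
  refine ⟨⟨x, hxQ⟩, rfl, ?_⟩
  have hlim := tendsto_finsetSum Finset.univ fun i _ =>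
    ((((hy i).sub_const (y i)).norm.pow 2).const_mul (c i))
  simp only [sub_self, norm_zero, ne_eq, OfNat.ofNat_ne_zero, not_false_eq_true, zero_pow,
    mul_zero, Finset.sum_const_zero] at hlim
  refine ((Complex.continuous_ofReal.tendsto 0).comp hlim).congr fun k => ?_
  rw [hself]
  simp only [map_sub, hTx, Function.comp_apply]

end Forms

section Components

variable {d : ℕ}

lemma isClosed_sector (d n : ℕ) : IsClosed (Sector d n : Set L²(Config d n)) := by
  have hsector : (Sector d n : Set L²(Config d n)) = ⋂ σ : Equiv.Perm (Fin n),
      {u | Lp.compMeasurePreserving (permute d n σ) (measurePreserving_permute d n σ) u = u} := by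
    ext u
    simp only [Set.mem_iInter, Set.mem_ofPred_eq]
    refine forall_congr' fun σ => ?_
    rw [Lp.ext_iff, (Lp.coeFn_compMeasurePreserving u (measurePreserving_permute d n σ)).congr_left]
    rfl
  rw [hsector]
  exact isClosed_iInter fun σ => isClosed_eq
    (Lp.isometry_compMeasurePreserving (measurePreserving_permute d n σ)).continuous continuous_id

instance completeSpace_sector (d n : ℕ) : CompleteSpace (Sector d n) :=
  (isClosed_sector d n).completeSpace_coe

/-- The `n`-boson component of a vector, as an element of `L²`. -/
def component (d n : ℕ) : Space d →L[ℂ] L²(Config d n) :=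
  LinearMap.mkContinuous
    { toFun := fun ψ => (ψ n : L²(Config d n))
      map_add' := fun _ _ => rfl
      map_smul' := fun _ _ => rfl } 1
    (fun ψ => by
      rw [one_mul]
      exact lp.norm_apply_le_norm two_ne_zero ψ n)

lemma coeFn_component (ψ : Space d) (n : ℕ) : (component d n ψ : Config d n → ℂ) = wave ψ n := rfl

lemma component_ext {φ ψ : Space d} (h : ∀ n, component d n φ = component d n ψ) : φ = ψ :=
  lp.ext (funext fun n => Subtype.ext (h n))

lemma hasSum_sq_norm_component (ψ : Space d) :
    HasSum (fun n => ‖component d n ψ‖ ^ 2) (‖ψ‖ ^ 2) := by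
  have hnorm (n : ℕ) : ‖component d n ψ‖ = ‖ψ n‖ := rfl
  simpa [hnorm] using lp.hasSum_norm (p := 2) (by norm_num) ψ

end Components

section FreeHamiltonian

variable {d : ℕ}

lemma mem_momentumGraph_iff {ħ : ℝ} {j : Fin d} {p : Space d × Space d} :
    p ∈ momentumGraph d ħ j ↔ ∀ n, IsWeakLineDeriv volume (EuclideanSpace.single j 1, 0)
      ((-(Complex.I * ħ)) • component d n p.1 : L²(Config d n)) (component d n p.2) := by
  refine forall_congr' fun n => forall₃_congr fun g _ _ => ?_
  have hsmul : ∫ x, fderiv ℝ g x (EuclideanSpace.single j 1, 0) •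
      ((-(Complex.I * ħ)) • component d n p.1 : L²(Config d n)) x
        = -(Complex.I * ħ) * ∫ x, partialQ j g x • wave p.1 n x := by
    rw [← integral_const_mul]
    refine integral_congr_ae ?_
    filter_upwards [Lp.coeFn_smul (-(Complex.I * ħ)) (component d n p.1)] with x hx
    rw [hx, Pi.smul_apply, coeFn_component, smul_comm, smul_eq_mul]
    rfl
  rw [hsmul, neg_mul, neg_neg]
  rfl

lemma graph_momentum (ħ : ℝ) (j : Fin d) : (momentum d ħ j).graph = momentumGraph d ħ j :=
  Submodule.toLinearPMap_graph_eq _ fun p hp => momentumGraph_functional d ħ j p hp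

lemma graph_sqrtNumber (d : ℕ) (ħ : ℝ) : (sqrtNumber d ħ).graph = sqrtNumberGraph d ħ :=
  Submodule.toLinearPMap_graph_eq _ fun p hp => sqrtNumberGraph_functional d ħ p hp

lemma mem_sqrtNumberGraph_iff {ħ : ℝ} {p : Space d × Space d} :
    p ∈ sqrtNumberGraph d ħ ↔
      ∀ n : ℕ, component d n p.2 = ((Real.sqrt (ħ * n) : ℝ) : ℂ) • component d n p.1 :=
  forall_congr' fun _ => Subtype.ext_iff

lemma isClosed_momentum (ħ : ℝ) (j : Fin d) : (momentum d ħ j).IsClosed := by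
  have hgraph : (momentumGraph d ħ j : Set (Space d × Space d)) = ⋂ n : ℕ,
      (fun p => ((-(Complex.I * ħ)) • component d n p.1, component d n p.2)) ⁻¹'
        {p | IsWeakLineDeriv volume (EuclideanSpace.single j 1, 0) p.1 p.2} := by
    ext p
    simp only [SetLike.mem_coe, mem_momentumGraph_iff, Set.mem_iInter, Set.mem_preimage,
      Set.mem_ofPred_eq]
  rw [LinearPMap.IsClosed, graph_momentum, hgraph]
  exact isClosed_iInter fun n => (isClosed_setOf_isWeakLineDeriv _).preimage (by fun_prop)

lemma isClosed_sqrtNumber (d : ℕ) (ħ : ℝ) : (sqrtNumber d ħ).IsClosed := by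
  have hgraph : (sqrtNumberGraph d ħ : Set (Space d × Space d)) = ⋂ n : ℕ,
      {p | component d n p.2 = ((Real.sqrt (ħ * n) : ℝ) : ℂ) • component d n p.1} := by
    ext p
    simp only [SetLike.mem_coe, mem_sqrtNumberGraph_iff, Set.mem_iInter, Set.mem_ofPred_eq]
  rw [LinearPMap.IsClosed, graph_sqrtNumber, hgraph]
  exact isClosed_iInter fun n => isClosed_eq (by fun_prop) (by fun_prop)

lemma mem_formDomain_iff {ħ : ℝ} {ψ : Space d} :
    ψ ∈ formDomain d ħ ↔ (∀ j, ∃ χ, (ψ, χ) ∈ momentumGraph d ħ j) ∧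
      ∃ χ, (ψ, χ) ∈ sqrtNumberGraph d ħ := by
  simp only [formDomain, Submodule.mem_inf, Submodule.mem_iInf, ← graph_momentum,
    ← graph_sqrtNumber, LinearPMap.mem_domain_iff]

lemma component_sqrtNumberQ (ħ : ℝ) (ψ : formDomain d ħ) (n : ℕ) :
    component d n (sqrtNumberQ d ħ ψ) = ((Real.sqrt (ħ * n) : ℝ) : ℂ) • component d n ψ := by
  have hmem : ((ψ : Space d), sqrtNumberQ d ħ ψ) ∈ sqrtNumberGraph d ħ :=
    graph_sqrtNumber d ħ ▸ (sqrtNumber d ħ).mem_graph ⟨ψ, ψ.2.2⟩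
  exact mem_sqrtNumberGraph_iff.1 hmem n

lemma hasDerivAt_translate_component {ħ : ℝ} (hħ : ħ ≠ 0) (j : Fin d) (ψ : formDomain d ħ) (n : ℕ) :
    HasDerivAt (fun t : ℝ => translate volume
        (t • ((EuclideanSpace.single j 1, 0) : Config d n)) (component d n ψ))
      ((Complex.I / ħ) • component d n (momentumQ d ħ j ψ)) 0 := by
  have hmem : ((ψ : Space d), momentumQ d ħ j ψ) ∈ momentumGraph d ħ j :=
    graph_momentum ħ j ▸ (momentum d ħ j).mem_graph ⟨ψ, (Submodule.mem_iInf _).1 ψ.2.1 j⟩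
  have hcancel : Complex.I / ħ * -(Complex.I * ħ) = 1 := by
    have hħ' : (ħ : ℂ) ≠ 0 := by exact_mod_cast hħ
    field_simp
    rw [Complex.I_sq, neg_neg]
  refine IsWeakLineDeriv.hasDerivAt_translate <|
    ((mem_momentumGraph_iff.1 hmem n).const_smul (Complex.I / ħ)).congr_ae ?_
      (Lp.coeFn_smul _ _).symm
  refine (Lp.coeFn_smul _ _).symm.trans ?_
  rw [smul_smul, hcancel, one_smul]

lemma freeForm_apply (ħ : ℝ) (φ ψ : formDomain d ħ) :
    freeForm d ħ φ ψ = (1 / 2 : ℂ) * ∑ j, inner ℂ (momentumQ d ħ j φ) (momentumQ d ħ j ψ)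
      + inner ℂ (sqrtNumberQ d ħ φ) (sqrtNumberQ d ħ ψ) := by
  simp [freeForm, LinearMap.sum_apply]

lemma freeForm_self (ħ : ℝ) (ψ : formDomain d ħ) :
    freeForm d ħ ψ ψ
      = ((1 / 2 * ∑ j, ‖momentumQ d ħ j ψ‖ ^ 2 + ‖sqrtNumberQ d ħ ψ‖ ^ 2 : ℝ) : ℂ) := by
  rw [freeForm_apply]
  simp only [inner_self_eq_norm_sq_to_K]
  push_cast
  rfl

open scoped ComplexOrder in
lemma freeForm_self_nonneg (ħ : ℝ) (ψ : formDomain d ħ) : 0 ≤ freeForm d ħ ψ ψ := by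
  rw [freeForm_self, Complex.zero_le_real]
  positivity

lemma sq_norm_momentumQ_le (ħ : ℝ) (j : Fin d) (ψ : formDomain d ħ) :
    ‖momentumQ d ħ j ψ‖ ^ 2 ≤ 2 * (freeForm d ħ ψ ψ).re := by
  have hle := Finset.single_le_sum (f := fun j => ‖momentumQ d ħ j ψ‖ ^ 2)
    (fun i _ => sq_nonneg _) (Finset.mem_univ j)
  rw [freeForm_self, Complex.ofReal_re]
  linarith [sq_nonneg ‖sqrtNumberQ d ħ ψ‖]

lemma sq_norm_sqrtNumberQ_le (ħ : ℝ) (ψ : formDomain d ħ) :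
    ‖sqrtNumberQ d ħ ψ‖ ^ 2 ≤ (freeForm d ħ ψ ψ).re := by
  rw [freeForm_self, Complex.ofReal_re, le_add_iff_nonneg_left]
  positivity

lemma isHermitianForm_freeForm (d : ℕ) (ħ : ℝ) : IsHermitianForm (freeForm d ħ) := by
  intro φ ψ
  have hhalf : conj (1 / 2 : ℂ) = 1 / 2 := by rw [map_div₀, map_one, map_ofNat]
  simp only [freeForm_apply, map_add, map_mul, map_sum, inner_conj_symm, hhalf]

lemma isClosedForm_freeForm (d : ℕ) (ħ : ℝ) : IsClosedForm (freeForm d ħ) := by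
  refine isClosedForm_of_eq_sum_sq_norm (c := fun i : Option (Fin d) => i.elim 1 fun _ => 1 / 2)
    (T := fun i => i.elim (sqrtNumber d ħ) (momentum d ħ))
    (TQ := fun i => i.elim (sqrtNumberQ d ħ) (momentumQ d ħ)) ?_ ?_ ?_ ?_ fun ψ => ?_
  · rintro (_ | j) <;> norm_num
  · rintro (_ | j)
    exacts [isClosed_sqrtNumber d ħ, isClosed_momentum ħ j]
  · rintro (_ | j) ψ
    exacts [(sqrtNumber d ħ).mem_graph ⟨ψ, ψ.2.2⟩,
      (momentum d ħ j).mem_graph ⟨ψ, (Submodule.mem_iInf _).1 ψ.2.1 j⟩]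
  · exact fun x hx => ⟨(Submodule.mem_iInf _).2 fun j => hx (some j), hx none⟩
  · rw [freeForm_self, Finset.mul_sum, add_comm]
    simp only [Fintype.sum_option, Option.elim_none, Option.elim_some, one_mul]

end FreeHamiltonian

section Density

variable {d n : ℕ}

/-- `permute` as a linear automorphism of the configuration space. -/
def permuteEquiv (d n : ℕ) (σ : Equiv.Perm (Fin n)) : Config d n ≃L[ℝ] Config d n :=
  (ContinuousLinearEquiv.refl ℝ (Rd d)).prodCongr
    (LinearEquiv.funCongrLeft ℝ (Rd d) σ).toContinuousLinearEquiv

lemma fderiv_permute_of_symmetric {f : Config d n → ℂ} (hsym : ∀ σ x, f (permute d n σ x) = f x)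
    (σ : Equiv.Perm (Fin n)) (x : Config d n) (v : Rd d) :
    fderiv ℝ f (permute d n σ x) (v, 0) = fderiv ℝ f x (v, 0) := by
  have hcomp : f ∘ permuteEquiv d n σ = f := funext (hsym σ)
  conv_rhs => rw [← hcomp, ContinuousLinearEquiv.comp_right_fderiv]
  rfl

/-- The sum of `g` over all relabellings of the bosons. -/
def symmetrize (g : Config d n → ℝ) (x : Config d n) : ℝ :=
  ∑ σ : Equiv.Perm (Fin n), g (permute d n σ x)

lemma symmetrize_permute (g : Config d n → ℝ) (σ : Equiv.Perm (Fin n)) (x : Config d n) :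
    symmetrize g (permute d n σ x) = symmetrize g x :=
  Fintype.sum_equiv (Equiv.mulLeft σ) _ _ fun _ => rfl

lemma contDiff_symmetrize {g : Config d n → ℝ} (hg : ContDiff ℝ ∞ g) :
    ContDiff ℝ ∞ (symmetrize g) :=
  ContDiff.sum fun σ _ => hg.comp (permuteEquiv d n σ).contDiff

lemma hasCompactSupport_comp_permute {g : Config d n → ℝ} (hc : HasCompactSupport g)
    (σ : Equiv.Perm (Fin n)) : HasCompactSupport fun x => g (permute d n σ x) :=
  hc.comp_homeomorph (permuteEquiv d n σ).toHomeomorph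

lemma hasCompactSupport_symmetrize {g : Config d n → ℝ} (hc : HasCompactSupport g) :
    HasCompactSupport (symmetrize g) := by
  have hsum : symmetrize g = ∑ σ : Equiv.Perm (Fin n), fun x => g (permute d n σ x) := by
    ext x
    rw [symmetrize, Finset.sum_apply]
  rw [hsum]
  exact Finset.sum_induction _ HasCompactSupport (fun _ _ => HasCompactSupport.add)
    HasCompactSupport.zero fun σ _ => hasCompactSupport_comp_permute hc σ

lemma integral_comp_permute_smul_wave (g : Config d n → ℝ) (σ : Equiv.Perm (Fin n)) (ψ : Space d) :
    ∫ x, g (permute d n σ x) • wave ψ n x = ∫ x, g x • wave ψ n x := by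
  have hmp := measurePreserving_permute d n σ
  refine Eq.trans (integral_congr_ae ?_) (hmp.integral_comp
    (permuteEquiv d n σ).toHomeomorph.measurableEmbedding fun x => g x • wave ψ n x)
  filter_upwards [(ψ n).2 σ] with x hx
  exact congrArg (g (permute d n σ x) • ·) hx.symm

lemma integral_symmetrize_smul_wave {g : Config d n → ℝ} (hg : Continuous g)
    (hc : HasCompactSupport g) (ψ : Space d) :
    ∫ x, symmetrize g x • wave ψ n x = n.factorial • ∫ x, g x • wave ψ n x := by
  have hinteg (σ : Equiv.Perm (Fin n)) :
      Integrable fun x => g (permute d n σ x) • wave ψ n x :=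
    integrable_wave_mul ψ n (hg.comp (permuteEquiv d n σ).continuous)
      (hasCompactSupport_comp_permute hc σ)
  simp only [symmetrize, Finset.sum_smul]
  rw [integral_finsetSum _ fun σ _ => hinteg σ]
  simp only [integral_comp_permute_smul_wave, Finset.sum_const, Finset.card_univ,
    Fintype.card_perm, Fintype.card_fin]

lemma exists_sector_ae_eq {f : Config d n → ℂ} (hf : MemLp f 2 volume)
    (hsym : ∀ σ x, f (permute d n σ x) = f x) :
    ∃ a : Sector d n, ((a : L²(Config d n)) : Config d n → ℂ) =ᵐ[volume] f := by
  refine ⟨⟨hf.toLp f, fun σ => ?_⟩, hf.coeFn_toLp⟩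
  filter_upwards [hf.coeFn_toLp,
    (measurePreserving_permute d n σ).quasiMeasurePreserving.ae hf.coeFn_toLp] with x hx hσx
  rw [hx, hσx, hsym]

lemma component_single_self (a : Sector d n) :
    component d n (lp.single 2 n a) = (a : L²(Config d n)) :=
  congrArg Subtype.val (lp.single_apply_self (E := fun n => Sector d n) 2 n a)

lemma component_single_of_ne {m : ℕ} (hmn : m ≠ n) (a : Sector d n) :
    component d m (lp.single 2 n a) = 0 :=
  congrArg Subtype.val (lp.single_apply_ne (E := fun n => Sector d n) 2 n a hmn)

lemma single_mem_momentumGraph {ħ : ℝ} {j : Fin d} {a b : Sector d n}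
    (h : IsWeakLineDeriv volume (EuclideanSpace.single j 1, 0)
      ((-(Complex.I * ħ)) • (a : L²(Config d n)) : L²(Config d n)) (b : L²(Config d n))) :
    (lp.single 2 n a, lp.single 2 n b) ∈ momentumGraph d ħ j := by
  refine mem_momentumGraph_iff.2 fun m => ?_
  rcases eq_or_ne m n with rfl | hmn
  · rwa [component_single_self, component_single_self]
  · rw [component_single_of_ne hmn, component_single_of_ne hmn]
    simpa only [Prod.fst_zero, Prod.snd_zero, map_zero] using
      mem_momentumGraph_iff.1 (zero_mem (momentumGraph d ħ j)) m

lemma single_mem_sqrtNumberGraph (ħ : ℝ) (a : Sector d n) :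
    (lp.single 2 n a, lp.single 2 n (((Real.sqrt (ħ * n) : ℝ) : ℂ) • a)) ∈
      sqrtNumberGraph d ħ := by
  refine mem_sqrtNumberGraph_iff.2 fun m => ?_
  rcases eq_or_ne m n with rfl | hmn
  · rw [component_single_self, component_single_self]
    rfl
  · rw [component_single_of_ne hmn, component_single_of_ne hmn, smul_zero]

lemma single_mem_formDomain (ħ : ℝ) {f : Config d n → ℂ} (hf : ContDiff ℝ ∞ f)
    (hc : HasCompactSupport f) (hsym : ∀ σ x, f (permute d n σ x) = f x) {a : Sector d n}
    (ha : ((a : L²(Config d n)) : Config d n → ℂ) =ᵐ[volume] f) :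
    lp.single 2 n a ∈ formDomain d ħ := by
  refine mem_formDomain_iff.2 ⟨fun j => ?_, _, single_mem_sqrtNumberGraph ħ a⟩
  have hderiv : Continuous fun x => fderiv ℝ f x (EuclideanSpace.single j 1, 0) :=
    (hf.continuous_fderiv (by simp)).clm_apply continuous_const
  obtain ⟨b, hb⟩ := exists_sector_ae_eq
    (hderiv.memLp_of_hasCompactSupport (hc.fderiv_apply (𝕜 := ℝ) _))
    (fun σ x => fderiv_permute_of_symmetric hsym σ x (EuclideanSpace.single j 1))
  refine ⟨lp.single 2 n ((-(Complex.I * ħ)) • b), single_mem_momentumGraph ?_⟩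
  refine ((isWeakLineDeriv_fderiv (hf.of_le (by simp)) _).const_smul
    (-(Complex.I * ħ))).congr_ae ?_ ?_
  · exact (ha.const_smul _).symm.trans (Lp.coeFn_smul _ _).symm
  · exact (hb.const_smul _).symm.trans (Lp.coeFn_smul _ _).symm

lemma inner_single {f : Config d n → ℂ} {a : Sector d n}
    (ha : ((a : L²(Config d n)) : Config d n → ℂ) =ᵐ[volume] f) (χ : Space d) :
    inner ℂ (lp.single 2 n a : Space d) χ = ∫ x, conj (f x) * wave χ n x := by
  rw [lp.inner_single_left, Submodule.coe_inner, L2.inner_def]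
  refine integral_congr_ae ?_
  filter_upwards [ha] with x hx
  rw [hx, RCLike.inner_apply, mul_comm]
  rfl

lemma integral_symmetrize_smul_wave_eq_zero {ħ : ℝ} {χ : Space d} (hχ : χ ∈ (formDomain d ħ)ᗮ)
    {g : Config d n → ℝ} (hg : ContDiff ℝ ∞ g) (hc : HasCompactSupport g) :
    ∫ x, symmetrize g x • wave χ n x = 0 := by
  have hsmooth : ContDiff ℝ ∞ fun x => (symmetrize g x : ℂ) :=
    Complex.ofRealCLM.contDiff.comp (contDiff_symmetrize hg)
  have hsupp : HasCompactSupport fun x => (symmetrize g x : ℂ) :=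
    (hasCompactSupport_symmetrize hc).comp_left (g := Complex.ofReal) Complex.ofReal_zero
  have hsym (σ : Equiv.Perm (Fin n)) (x : Config d n) :
      (symmetrize g (permute d n σ x) : ℂ) = symmetrize g x :=
    congrArg Complex.ofReal (symmetrize_permute g σ x)
  obtain ⟨a, ha⟩ :=
    exists_sector_ae_eq (hsmooth.continuous.memLp_of_hasCompactSupport hsupp) hsym
  have horth := Submodule.inner_right_of_mem_orthogonal
    (single_mem_formDomain ħ hsmooth hsupp hsym ha) hχ
  rw [inner_single ha] at horth
  simpa only [Complex.conj_ofReal, Complex.real_smul] using horth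

lemma dense_formDomain (d : ℕ) (ħ : ℝ) : Dense (formDomain d ħ : Set (Space d)) := by
  rw [Submodule.dense_iff_topologicalClosure_eq_top, Submodule.topologicalClosure_eq_top_iff,
    Submodule.eq_bot_iff]
  refine fun χ hχ => component_ext fun n => Lp_ext_of_integral_contDiff_smul fun g hg hc => ?_
  have hzero : ∫ x, g x • wave χ n x = 0 := by
    have hsum := integral_symmetrize_smul_wave_eq_zero hχ hg hc
    rwa [integral_symmetrize_smul_wave hg.continuous hc,
      smul_eq_zero_iff_right n.factorial_ne_zero] at hsum
  rw [coeFn_component, hzero, map_zero]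
  refine (integral_eq_zero_of_ae ?_).symm
  filter_upwards [Lp.coeFn_zero ℂ 2 (volume : Measure (Config d n))] with x hx
  rw [hx, Pi.zero_apply, smul_zero]

end Density

section Hopping

variable {d : ℕ} {ħ : ℝ}

/-- The square-summable sequences of square-integrable functions of `1, 2, …` bosons. They need not
be symmetric, so that a boson can be added as the first one, without symmetrizing. -/
abbrev EmissionSpace (d : ℕ) : Type := lp (fun n : ℕ => L²(Config d (n + 1))) 2

lemma norm_tensor_comp_subtypeL_le (h : L²(Rd d)) (n : ℕ) :
    ‖(tensor d n h).comp (Sector d n).subtypeL‖ ≤ ‖h‖ :=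
  ContinuousLinearMap.opNorm_le_bound _ (norm_nonneg h) fun u =>
    (norm_tensor h (u : L²(Config d n))).le

/-- The emission of a boson with wave function `h`: creation without symmetrization and without the
factors `√(ħ(n+1))`. -/
def emission (d : ℕ) : L²(Rd d) →ₗ[ℂ] Space d →L[ℂ] EmissionSpace d where
  toFun h := lp.mapCLM 2 (fun n => (tensor d n h).comp (Sector d n).subtypeL) (norm_nonneg h)
    (norm_tensor_comp_subtypeL_le h)
  map_add' h h' := by
    ext1 φ
    refine lp.ext (funext fun n => ?_)
    exact congrArg (fun T => T (component d n φ)) (map_add (tensor d n) h h')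
  map_smul' c h := by
    ext1 φ
    refine lp.ext (funext fun n => ?_)
    exact congrArg (fun T => T (component d n φ)) (map_smul (tensor d n) c h)

lemma norm_emission_le (h : L²(Rd d)) (φ : Space d) : ‖emission d h φ‖ ≤ ‖h‖ * ‖φ‖ :=
  (emission d h).le_of_opNorm_le
    (lp.norm_mapCLM_le 2 _ (norm_nonneg h) (norm_tensor_comp_subtypeL_le h)) φ

lemma memℓp_component_succ (χ : Space d) : Memℓp (fun n => component d (n + 1) χ) 2 := by
  refine memℓp_gen ?_
  simpa using (summable_nat_add_iff 1).2 (hasSum_sq_norm_component χ).summable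

/-- The components of a vector with at least one boson. -/
def dropVacuum (d : ℕ) : Space d →ₗ[ℂ] EmissionSpace d where
  toFun χ := ⟨fun n => component d (n + 1) χ, memℓp_component_succ χ⟩
  map_add' _ _ := rfl
  map_smul' _ _ := rfl

lemma dropVacuum_apply (χ : Space d) (n : ℕ) : dropVacuum d χ n = component d (n + 1) χ := rfl

lemma norm_dropVacuum_le (χ : Space d) : ‖dropVacuum d χ‖ ≤ ‖χ‖ := by
  have hsum : HasSum (fun n => ‖component d (n + 1) χ‖ ^ 2) (‖dropVacuum d χ‖ ^ 2) := by
    simpa [dropVacuum_apply] using lp.hasSum_norm (p := 2) (by norm_num) (dropVacuum d χ)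
  exact le_of_sq_le_sq (hasSum_le_inj (· + 1) (add_left_injective 1)
    (fun n _ => sq_nonneg ‖component d n χ‖) (fun _ => le_rfl) hsum (hasSum_sq_norm_component χ))
    (norm_nonneg χ)

lemma sqrt_add_le_sqrt_add_sqrt (x y : ℝ) : Real.sqrt (x + y) ≤ Real.sqrt x + Real.sqrt y := by
  refine Real.sqrt_le_iff.2 ⟨by positivity, ?_⟩
  rw [add_sq, Real.sq_sqrt', Real.sq_sqrt']
  linarith [le_max_left x 0, le_max_left y 0, mul_nonneg (Real.sqrt_nonneg x) (Real.sqrt_nonneg y)]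

lemma norm_sqrt_succ_smul_le (ψ : formDomain d ħ) (n : ℕ) :
    ‖((Real.sqrt (ħ * (n + 1)) : ℝ) : ℂ) • (ψ : Space d) n‖
      ≤ ‖sqrtNumberQ d ħ ψ n‖ + Real.sqrt ħ * ‖(ψ : Space d) n‖ := by
  have hnumber : ‖sqrtNumberQ d ħ ψ n‖ = Real.sqrt (ħ * n) * ‖(ψ : Space d) n‖ := by
    refine (congrArg norm (component_sqrtNumberQ ħ ψ n)).trans ?_
    rw [norm_smul, Complex.norm_real, Real.norm_of_nonneg (Real.sqrt_nonneg _)]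
    rfl
  rw [hnumber, norm_smul, Complex.norm_real, Real.norm_of_nonneg (Real.sqrt_nonneg _), ← add_mul,
    mul_add_one]
  exact mul_le_mul_of_nonneg_right (sqrt_add_le_sqrt_add_sqrt _ _) (norm_nonneg _)

/-- The sequence `‖(N_ħ^{1/2} ψ)ₙ‖ + √ħ ‖ψₙ‖`, which dominates `√(ħ(n+1)) ‖ψₙ‖`. -/
def sqrtNumberMajorant (ψ : formDomain d ħ) : lp (fun _ : ℕ => ℝ) 2 :=
  lp.toNorm (sqrtNumberQ d ħ ψ) + Real.sqrt ħ • lp.toNorm (ψ : Space d)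

/-- The operator `(N_ħ + ħ)^{1/2}` on the form domain. -/
def sqrtNumberSuccQ (d : ℕ) (ħ : ℝ) : formDomain d ħ →ₗ[ℂ] Space d where
  toFun ψ := ⟨fun n => ((Real.sqrt (ħ * (n + 1)) : ℝ) : ℂ) • (ψ : Space d) n,
    (lp.memℓp (sqrtNumberMajorant ψ)).mono (norm_sqrt_succ_smul_le ψ)⟩
  map_add' _ _ := lp.ext (funext fun _ => smul_add _ _ _)
  map_smul' c ψ := lp.ext (funext fun n => smul_comm _ c ((ψ : Space d) n))

lemma norm_sqrtNumberSuccQ_le (ψ : formDomain d ħ) :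
    ‖sqrtNumberSuccQ d ħ ψ‖ ≤ ‖sqrtNumberQ d ħ ψ‖ + Real.sqrt ħ * ‖(ψ : Space d)‖ := by
  have hsmul : ‖Real.sqrt ħ • lp.toNorm (ψ : Space d)‖ ≤ Real.sqrt ħ * ‖(ψ : Space d)‖ :=
    (norm_smul_le (Real.sqrt ħ) (lp.toNorm (ψ : Space d))).trans_eq
      (congrArg₂ (· * ·) (Real.norm_of_nonneg (Real.sqrt_nonneg ħ)) lp.norm_toNorm)
  calc ‖sqrtNumberSuccQ d ħ ψ‖ ≤ ‖sqrtNumberMajorant ψ‖ :=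
        lp.norm_mono two_ne_zero fun n => (norm_sqrt_succ_smul_le ψ n).trans (le_abs_self _)
    _ ≤ ‖sqrtNumberQ d ħ ψ‖ + Real.sqrt ħ * ‖(ψ : Space d)‖ :=
        norm_add_le_of_le lp.norm_toNorm.le hsmul

/-- The form `(φ, ψ) ↦ ∑ₙ ⟨h ⊗ (S φ)ₙ, (T ψ)ₙ₊₁⟩`. -/
def hopForm {Q : Submodule ℂ (Space d)} (S T : Q →ₗ[ℂ] Space d) (h : L²(Rd d)) : SesqForm Q :=
  ((innerₛₗ ℂ).comp ((emission d h).toLinearMap ∘ₗ S)).compl₂ (dropVacuum d ∘ₗ T)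

section hopForm

variable {Q : Submodule ℂ (Space d)} (S T : Q →ₗ[ℂ] Space d) (φ ψ : Q)

lemma hopForm_apply (h : L²(Rd d)) :
    hopForm S T h φ ψ = inner ℂ (emission d h (S φ)) (dropVacuum d (T ψ)) := rfl

lemma hasSum_hopForm (h : L²(Rd d)) :
    HasSum (fun n => inner ℂ (tensor d n h (component d n (S φ))) (component d (n + 1) (T ψ)))
      (hopForm S T h φ ψ) :=
  lp.hasSum_inner (emission d h (S φ)) (dropVacuum d (T ψ))

lemma hopForm_sub (h h' : L²(Rd d)) : hopForm S T (h - h') = hopForm S T h - hopForm S T h' := by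
  ext φ ψ
  simp [hopForm_apply]

lemma hopForm_sum {ι : Type*} (s : Finset ι) (h : ι → L²(Rd d)) :
    hopForm S T (∑ i ∈ s, h i) = ∑ i ∈ s, hopForm S T (h i) := by
  ext φ ψ
  simp [hopForm_apply, LinearMap.sum_apply]

lemma norm_hopForm_le (h : L²(Rd d)) : ‖hopForm S T h φ ψ‖ ≤ ‖h‖ * ‖S φ‖ * ‖T ψ‖ :=
  (norm_inner_le_norm _ _).trans (mul_le_mul (norm_emission_le h _) (norm_dropVacuum_le _)
    (norm_nonneg _) (by positivity))

end hopForm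

end Hopping

section Hermitize

variable {H : Type*} [NormedAddCommGroup H] [InnerProductSpace ℂ H] {Q : Submodule ℂ H}

/-- The Hermitian form `(B(φ, ψ) + conj B(ψ, φ)) / √2`, which turns the form of the annihilation
operator into that of the Segal field. -/
def hermitize (B : SesqForm Q) : SesqForm Q :=
  LinearMap.mk₂'ₛₗ (starRingEnd ℂ) (RingHom.id ℂ)
    (fun φ ψ => (B φ ψ + conj (B ψ φ)) / (Real.sqrt 2 : ℝ))
    (by intro φ φ' ψ; simp only [map_add, LinearMap.add_apply]; ring)
    (by intro c φ ψ; simp only [LinearMap.map_smulₛₗ, LinearMap.smul_apply, smul_eq_mul, map_mul,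
          RingHom.id_apply]; ring)
    (by intro φ ψ ψ'; simp only [map_add, LinearMap.add_apply]; ring)
    (by intro c φ ψ; simp only [LinearMap.map_smulₛₗ, LinearMap.smul_apply, smul_eq_mul, map_mul,
          RingHom.id_apply, Complex.conj_conj]; ring)

lemma hermitize_apply (B : SesqForm Q) (φ ψ : Q) :
    hermitize B φ ψ = (B φ ψ + conj (B ψ φ)) / (Real.sqrt 2 : ℝ) := rfl

lemma isHermitianForm_hermitize (B : SesqForm Q) : IsHermitianForm (hermitize B) := by
  intro φ ψ
  simp only [hermitize_apply, map_div₀, map_add, Complex.conj_conj, Complex.conj_ofReal, add_comm]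

lemma norm_hermitize_self_le (B : SesqForm Q) (ψ : Q) : ‖hermitize B ψ ψ‖ ≤ 2 * ‖B ψ ψ‖ := by
  rw [hermitize_apply, norm_div, Complex.norm_real, Real.norm_of_nonneg (Real.sqrt_nonneg _)]
  refine (div_le_self (norm_nonneg _) (Real.one_le_sqrt.2 one_le_two)).trans ?_
  rw [two_mul]
  exact norm_add_le_of_le le_rfl (RCLike.norm_conj _).le

lemma isInfinitesimallyFormBounded_of_forall_eq_add {B h₀ : SesqForm Q}
    (hB : ∀ ε > 0, ∃ (B₁ B₂ : SesqForm Q) (C : ℝ), B = B₁ + B₂ ∧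
      IsInfinitesimallyFormBounded B₁ h₀ ∧
      ∀ ψ : Q, ‖B₂ ψ ψ‖ ≤ ε * (h₀ ψ ψ).re + C * ‖(ψ : H)‖ ^ 2) :
    IsInfinitesimallyFormBounded B h₀ := by
  intro ε hε
  obtain ⟨B₁, B₂, C₂, rfl, hB₁, hC₂⟩ := hB (ε / 2) (by positivity)
  obtain ⟨C₁, hC₁⟩ := hB₁ (ε / 2) (by positivity)
  refine ⟨C₁ + C₂, fun ψ => ?_⟩
  rw [LinearMap.add_apply, LinearMap.add_apply]
  linarith [norm_add_le (B₁ ψ ψ) (B₂ ψ ψ), hC₁ ψ, hC₂ ψ]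

lemma IsInfinitesimallyFormBounded.hermitize {B h₀ : SesqForm Q}
    (hB : IsInfinitesimallyFormBounded B h₀) :
    IsInfinitesimallyFormBounded (hermitize B) h₀ := by
  intro ε hε
  obtain ⟨C, hC⟩ := hB (ε / 2) (by positivity)
  exact ⟨2 * C, fun ψ => by linarith [norm_hermitize_self_le B ψ, hC ψ]⟩

end Hermitize

section Commutator

variable {d : ℕ} {ħ : ℝ}

/-- The form `⟨φ, a_ħ(f_q̂) ψ⟩` for `f_q(k) = e^{-i k·q} h(k)` with square-integrable `h`. -/
def annForm (d : ℕ) (ħ : ℝ) (h : L²(Rd d)) : SesqForm (formDomain d ħ) :=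
  hopForm (formDomain d ħ).subtype (sqrtNumberQ d ħ) h

/-- The form of `ħ⁻¹ [p̂ⱼ, a_ħ(g_q̂)]` for `g_q(k) = e^{-i k·q} G(k)`. It is `annForm` of `kⱼ G` if
that is square-integrable, but is defined for all square-integrable `G`. -/
def commForm (d : ℕ) (ħ : ℝ) (j : Fin d) (G : L²(Rd d)) : SesqForm (formDomain d ħ) :=
  (ħ : ℂ)⁻¹ • (hopForm (momentumQ d ħ j) (sqrtNumberQ d ħ) G
    - hopForm (sqrtNumberSuccQ d ħ) (momentumQ d ħ j) G)

lemma inner_tensor_smul_left (h : L²(Rd d)) {n : ℕ} (c : ℂ) (u : L²(Config d n))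
    (v : L²(Config d (n + 1))) :
    inner ℂ (tensor d n h (c • u)) v = conj c * inner ℂ (tensor d n h u) v := by
  have hsmul : tensor d n h (c • u) = c • tensor d n h u := (tensor d n h).map_smul c u
  rw [hsmul]
  exact inner_smul_left (tensor d n h u) v c

lemma inner_tensor_sqrtNumberSuccQ (h : L²(Rd d)) (φ : formDomain d ħ) (n : ℕ)
    (v : L²(Config d (n + 1))) :
    inner ℂ (tensor d n h (component d n (sqrtNumberSuccQ d ħ φ))) v
      = ((Real.sqrt (ħ * (n + 1)) : ℝ) : ℂ) * inner ℂ (tensor d n h (component d n φ)) v :=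
  (inner_tensor_smul_left h _ (component d n φ) v).trans
    (congrArg (· * inner ℂ (tensor d n h (component d n φ)) v) (Complex.conj_ofReal _))

lemma component_succ_sqrtNumberQ (ψ : formDomain d ħ) (n : ℕ) :
    component d (n + 1) (sqrtNumberQ d ħ ψ)
      = ((Real.sqrt (ħ * (n + 1)) : ℝ) : ℂ) • component d (n + 1) ψ := by
  rw [component_sqrtNumberQ, Nat.cast_succ]

lemma hasSum_hopForm_sqrtNumberQ (S : formDomain d ħ →ₗ[ℂ] Space d) (h : L²(Rd d))
    (φ ψ : formDomain d ħ) :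
    HasSum (fun n : ℕ => ((Real.sqrt (ħ * (n + 1)) : ℝ) : ℂ) *
        inner ℂ (tensor d n h (component d n (S φ))) (component d (n + 1) ψ))
      (hopForm S (sqrtNumberQ d ħ) h φ ψ) := by
  simpa only [component_succ_sqrtNumberQ, inner_smul_right]
    using hasSum_hopForm S (sqrtNumberQ d ħ) φ ψ h

lemma hasSum_annForm (h : L²(Rd d)) (φ ψ : formDomain d ħ) :
    HasSum (fun n : ℕ => ((Real.sqrt (ħ * (n + 1)) : ℝ) : ℂ) *
        inner ℂ (tensor d n h (component d n φ)) (component d (n + 1) ψ)) (annForm d ħ h φ ψ) :=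
  hasSum_hopForm_sqrtNumberQ (formDomain d ħ).subtype h φ ψ

lemma hasSum_hopForm_sqrtNumberSuccQ (T : formDomain d ħ →ₗ[ℂ] Space d) (h : L²(Rd d))
    (φ ψ : formDomain d ħ) :
    HasSum (fun n : ℕ => ((Real.sqrt (ħ * (n + 1)) : ℝ) : ℂ) *
        inner ℂ (tensor d n h (component d n φ)) (component d (n + 1) (T ψ)))
      (hopForm (sqrtNumberSuccQ d ħ) T h φ ψ) := by
  refine (hasSum_hopForm (sqrtNumberSuccQ d ħ) T φ ψ h).congr_fun fun n => ?_
  exact (inner_tensor_sqrtNumberSuccQ h φ n (component d (n + 1) (T ψ))).symm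

lemma commForm_sub (j : Fin d) (G G' : L²(Rd d)) :
    commForm d ħ j (G - G') = commForm d ħ j G - commForm d ħ j G' := by
  have hsub := congrArg₂ (fun A B : SesqForm (formDomain d ħ) => (ħ : ℂ)⁻¹ • (A - B))
    (hopForm_sub (momentumQ d ħ j) (sqrtNumberQ d ħ) G G')
    (hopForm_sub (sqrtNumberSuccQ d ħ) (momentumQ d ħ j) G G')
  exact hsub.trans <| (congrArg ((ħ : ℂ)⁻¹ • ·) (sub_sub_sub_comm _ _ _ _)).trans
    (smul_sub (ħ : ℂ)⁻¹ _ _)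

lemma inner_tensor_mul_coord (hħ : ħ ≠ 0) (j : Fin d) {h kh : L²(Rd d)}
    (hkh : kh =ᵐ[volume] fun k => (k j : ℂ) * h k) (φ ψ : formDomain d ħ) (n : ℕ) :
    inner ℂ (tensor d n kh (component d n φ)) (component d (n + 1) ψ)
      = (ħ : ℂ)⁻¹ *
        (inner ℂ (tensor d n h (component d n (momentumQ d ħ j φ))) (component d (n + 1) ψ)
          - inner ℂ (tensor d n h (component d n φ))
              (component d (n + 1) (momentumQ d ħ j ψ))) := by
  have hcomm := inner_tensor_mul_eq_neg_add (EuclideanSpace.single j 1) (h := h) (kh := kh)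
    (by simpa [EuclideanSpace.inner_single_right] using hkh)
    (hasDerivAt_translate_component hħ j φ n) (hasDerivAt_translate_component hħ j ψ (n + 1))
  refine mul_left_cancel₀ Complex.I_ne_zero <| hcomm.trans <|
    (congrArg₂ (fun x y : ℂ => -(x + y))
      (inner_tensor_smul_left h _ (component d n (momentumQ d ħ j φ)) (component d (n + 1) ψ))
      (inner_smul_right (tensor d n h (component d n φ))
        (component d (n + 1) (momentumQ d ħ j ψ)) _)).trans ?_
  simp only [map_div₀, Complex.conj_I, Complex.conj_ofReal]
  ring

lemma annForm_mul_coord (hħ : ħ ≠ 0) (j : Fin d) {h kh : L²(Rd d)}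
    (hkh : kh =ᵐ[volume] fun k => (k j : ℂ) * h k) : annForm d ħ kh = commForm d ħ j h := by
  ext φ ψ
  have hcomm := ((hasSum_hopForm_sqrtNumberQ (momentumQ d ħ j) h φ ψ).sub
    (hasSum_hopForm_sqrtNumberSuccQ (momentumQ d ħ j) h φ ψ)).mul_left (ħ : ℂ)⁻¹
  refine (hasSum_annForm kh φ ψ).unique (hcomm.congr_fun fun n => ?_)
  rw [inner_tensor_mul_coord hħ j hkh]
  ring

lemma exists_mul_coord (j : Fin d) {h : L²(Rd d)} {r : ℝ} (hr : ∀ᵐ k, r < ‖k‖ → h k = 0) :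
    ∃ kh : L²(Rd d), kh =ᵐ[volume] fun k => (k j : ℂ) * h k := by
  have hmem : MemLp (fun k : Rd d => (k j : ℂ) * h k) 2 volume := by
    refine (Lp.memLp h).of_le_mul (c := r) ?_ ?_
    · exact (Continuous.aestronglyMeasurable (by fun_prop)).mul (Lp.aestronglyMeasurable h)
    · filter_upwards [hr] with k hk
      obtain hle | hlt := le_or_gt ‖k‖ r
      · rw [norm_mul, Complex.norm_real]
        exact mul_le_mul_of_nonneg_right ((PiLp.norm_apply_le k j).trans hle) (norm_nonneg _)
      · rw [hk hlt, mul_zero, norm_zero, mul_zero]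
  exact ⟨hmem.toLp _, hmem.coeFn_toLp⟩

lemma annForm_sum_mul_coord (hħ : ħ ≠ 0) {h : L²(Rd d)} {G : Fin d → L²(Rd d)} {r : ℝ}
    (hG : ∀ j, ∀ᵐ k, r < ‖k‖ → G j k = 0)
    (hh : h =ᵐ[volume] fun k => ∑ j, (k j : ℂ) * G j k) :
    annForm d ħ h = ∑ j, commForm d ħ j (G j) := by
  choose kG hkG using fun j => exists_mul_coord j (hG j)
  have hsum : h = ∑ j, kG j := by
    apply Lp.ext
    filter_upwards [hh, ae_all_iff.2 hkG, Lp.coeFn_finsetSum Finset.univ kG] with k hk hkG hsum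
    rw [hk, hsum, Finset.sum_apply]
    exact Finset.sum_congr rfl fun j _ => (hkG j).symm
  rw [hsum, annForm, hopForm_sum]
  exact Finset.sum_congr rfl fun j _ => annForm_mul_coord hħ j (hkG j)

lemma norm_annForm_le (h : L²(Rd d)) (φ ψ : formDomain d ħ) :
    ‖annForm d ħ h φ ψ‖ ≤ ‖h‖ * ‖(φ : Space d)‖ * ‖sqrtNumberQ d ħ ψ‖ :=
  norm_hopForm_le _ _ φ ψ h

lemma norm_inv_mul_sub_le (hħ : 0 ≤ ħ) {x y : ℂ} {a b : ℝ} (hx : ‖x‖ ≤ a) (hy : ‖y‖ ≤ b) :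
    ‖(ħ : ℂ)⁻¹ * (x - y)‖ ≤ ħ⁻¹ * (a + b) := by
  rw [norm_mul, norm_inv, Complex.norm_of_nonneg hħ]
  exact mul_le_mul_of_nonneg_left (norm_sub_le_of_le hx hy) (inv_nonneg.2 hħ)

lemma norm_commForm_le (hħ : 0 ≤ ħ) (j : Fin d) (G : L²(Rd d)) (φ ψ : formDomain d ħ) :
    ‖commForm d ħ j G φ ψ‖ ≤ ħ⁻¹ * ‖G‖ * (‖momentumQ d ħ j φ‖ * ‖sqrtNumberQ d ħ ψ‖
      + ‖sqrtNumberSuccQ d ħ φ‖ * ‖momentumQ d ħ j ψ‖) := by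
  refine (norm_inv_mul_sub_le hħ
    (norm_hopForm_le (momentumQ d ħ j) (sqrtNumberQ d ħ) φ ψ G)
    (norm_hopForm_le (sqrtNumberSuccQ d ħ) (momentumQ d ħ j) φ ψ G)).trans_eq ?_
  ring

lemma norm_commForm_self_le (hħ : 0 ≤ ħ) (j : Fin d) (G : L²(Rd d)) (ψ : formDomain d ħ) :
    ‖commForm d ħ j G ψ ψ‖
      ≤ ħ⁻¹ * ‖G‖ * (4 * (freeForm d ħ ψ ψ).re + ħ * ‖(ψ : Space d)‖ ^ 2) := by
  refine (norm_commForm_le hħ j G ψ ψ).trans (mul_le_mul_of_nonneg_left ?_ (by positivity))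
  have hsucc := mul_le_mul_of_nonneg_right (norm_sqrtNumberSuccQ_le ψ)
    (norm_nonneg (momentumQ d ħ j ψ))
  have hmul := two_mul_le_add_sq (Real.sqrt ħ * ‖(ψ : Space d)‖) ‖momentumQ d ħ j ψ‖
  rw [mul_pow, Real.sq_sqrt hħ] at hmul
  have hħψ : 0 ≤ ħ * ‖(ψ : Space d)‖ ^ 2 := by positivity
  linarith [two_mul_le_add_sq ‖momentumQ d ħ j ψ‖ ‖sqrtNumberQ d ħ ψ‖, sq_norm_momentumQ_le ħ j ψ,
    sq_norm_sqrtNumberQ_le ħ ψ]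

lemma isInfinitesimallyFormBounded_annForm (h : L²(Rd d)) :
    IsInfinitesimallyFormBounded (annForm d ħ h) (freeForm d ħ) := by
  refine fun ε hε => ⟨‖h‖ ^ 2 / (4 * ε), fun ψ => (norm_annForm_le h ψ ψ).trans ?_⟩
  have hsq : 0 ≤ (ε * ‖sqrtNumberQ d ħ ψ‖ - ‖h‖ * ‖(ψ : Space d)‖ / 2) ^ 2 / ε := by positivity
  calc ‖h‖ * ‖(ψ : Space d)‖ * ‖sqrtNumberQ d ħ ψ‖
      ≤ ‖h‖ * ‖(ψ : Space d)‖ * ‖sqrtNumberQ d ħ ψ‖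
        + (ε * ‖sqrtNumberQ d ħ ψ‖ - ‖h‖ * ‖(ψ : Space d)‖ / 2) ^ 2 / ε := by linarith
    _ = ε * ‖sqrtNumberQ d ħ ψ‖ ^ 2 + ‖h‖ ^ 2 / (4 * ε) * ‖(ψ : Space d)‖ ^ 2 := by
        field_simp
        ring
    _ ≤ _ := by
        gcongr
        exact sq_norm_sqrtNumberQ_le ħ ψ

lemma norm_sum_fin_le_mul {f : Fin d → ℂ} {a : ℝ} (hf : ∀ j, ‖f j‖ ≤ a) :
    ‖∑ j, f j‖ ≤ d * a := by
  refine (norm_sum_le_of_le Finset.univ fun j _ => hf j).trans_eq ?_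
  rw [Finset.sum_const, Finset.card_univ, Fintype.card_fin, nsmul_eq_mul]

lemma norm_sum_commForm_self_le (hħ : 0 < ħ) {δ : ℝ} {G : Fin d → L²(Rd d)}
    (hG : ∀ j, ‖G j‖ ≤ δ) (ψ : formDomain d ħ) :
    ‖(∑ j, commForm d ħ j (G j)) ψ ψ‖
      ≤ d * (ħ⁻¹ * δ * (4 * (freeForm d ħ ψ ψ).re + ħ * ‖(ψ : Space d)‖ ^ 2)) := by
  have hE : 0 ≤ (freeForm d ħ ψ ψ).re := (sq_nonneg _).trans (sq_norm_sqrtNumberQ_le ħ ψ)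
  have hcomm (j : Fin d) : ‖commForm d ħ j (G j) ψ ψ‖
      ≤ ħ⁻¹ * δ * (4 * (freeForm d ħ ψ ψ).re + ħ * ‖(ψ : Space d)‖ ^ 2) :=
    (norm_commForm_self_le hħ.le j (G j) ψ).trans <| mul_le_mul_of_nonneg_right
      (mul_le_mul_of_nonneg_left (hG j) (inv_nonneg.2 hħ.le)) (by positivity)
  simp only [LinearMap.sum_apply]
  exact norm_sum_fin_le_mul hcomm

lemma isInfinitesimallyFormBounded_of_eq_annForm_add_sum_commForm (hħ : 0 < ħ)
    {B : SesqForm (formDomain d ħ)}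
    (hB : ∀ δ > 0, ∃ (h : L²(Rd d)) (G : Fin d → L²(Rd d)), (∀ j, ‖G j‖ ≤ δ) ∧
      B = annForm d ħ h + ∑ j, commForm d ħ j (G j)) :
    IsInfinitesimallyFormBounded B (freeForm d ħ) := by
  refine isInfinitesimallyFormBounded_of_forall_eq_add fun ε hε => ?_
  obtain ⟨h, G, hG, hBG⟩ := hB (ε * ħ / (4 * (d + 1))) (by positivity)
  refine ⟨annForm d ħ h, ∑ j, commForm d ħ j (G j), ε * ħ / 4, hBG,
    isInfinitesimallyFormBounded_annForm h, fun ψ => ?_⟩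
  have hE : 0 ≤ (freeForm d ħ ψ ψ).re := (sq_nonneg _).trans (sq_norm_sqrtNumberQ_le ħ ψ)
  have hscale (x : ℝ) :
      d * (ħ⁻¹ * (ε * ħ / (4 * (d + 1))) * x) = d / (d + 1) * (ε / 4 * x) := by
    field_simp
  refine ((norm_sum_commForm_self_le hħ hG ψ).trans_eq (hscale _)).trans ?_
  refine (mul_le_of_le_one_left (by positivity)
    ((div_le_one (by positivity)).2 (by linarith))).trans_eq ?_
  ring

end Commutator

section Kernel

variable {d n : ℕ}

/-- The integrand of `⟨u, a(F) v⟩` as a function on the configurations of `n + 1` bosons, the first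
of which is annihilated. -/
def kernel (F : Rd d → Rd d → ℂ) (u : Config d n → ℂ) (v : Config d (n + 1) → ℂ)
    (y : Config d (n + 1)) : ℂ :=
  conj (u (y.1, Fin.tail y.2)) * conj (F y.1 (y.2 0)) * v y

variable {F : Rd d → Rd d → ℂ} {u : Config d n → ℂ} {v : Config d (n + 1) → ℂ}

lemma measurable_kernel (hF : Measurable (Function.uncurry F)) (hu : Measurable u)
    (hv : Measurable v) : Measurable (kernel F u v) := by
  have hF_head : Measurable fun y : Config d (n + 1) => F y.1 (y.2 0) :=
    hF.comp (measurable_fst.prodMk ((measurable_pi_apply 0).comp measurable_snd))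
  exact ((Complex.continuous_conj.measurable.comp
    (hu.comp quasiMeasurePreserving_tail.measurable)).mul
      (Complex.continuous_conj.measurable.comp hF_head)).mul hv

lemma kernel_splitFirst_symm (F : Rd d → Rd d → ℂ) (u : Config d n → ℂ)
    (v : Config d (n + 1) → ℂ) (p : Config d n × Rd d) :
    kernel F u v ((splitFirst d n).symm p)
      = conj (u p.1) * (conj (F p.1.1 p.2) * v (p.1.1, Fin.cons p.2 p.1.2)) := by
  rw [splitFirst_symm_apply]
  simp [kernel, mul_assoc]

lemma integrable_kernel_splitFirst_symm (h : Integrable (kernel F u v)) :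
    Integrable fun p : Config d n × Rd d =>
      conj (u p.1) * (conj (F p.1.1 p.2) * v (p.1.1, Fin.cons p.2 p.1.2)) :=
  (measurePreserving_splitFirst.symm.integrable_comp_of_integrable h).congr
    (Eventually.of_forall (kernel_splitFirst_symm F u v))

lemma integrable_conj_mul_integral (h : Integrable (kernel F u v)) :
    Integrable fun x : Config d n =>
      conj (u x) * ∫ k : Rd d, conj (F x.1 k) * v (x.1, Fin.cons k x.2) :=
  (integrable_kernel_splitFirst_symm h).integral_prod_left.congr
    (Eventually.of_forall fun x => integral_const_mul (conj (u x)) _)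

lemma integral_conj_mul_integral (h : Integrable (kernel F u v)) :
    ∫ x : Config d n, conj (u x) * ∫ k : Rd d, conj (F x.1 k) * v (x.1, Fin.cons k x.2)
      = ∫ y, kernel F u v y := by
  calc ∫ x : Config d n, conj (u x) * ∫ k : Rd d, conj (F x.1 k) * v (x.1, Fin.cons k x.2)
      = ∫ x : Config d n, ∫ k : Rd d,
          conj (u x) * (conj (F x.1 k) * v (x.1, Fin.cons k x.2)) :=
        integral_congr_ae (Eventually.of_forall fun x => (integral_const_mul _ _).symm)
    _ = ∫ p : Config d n × Rd d,
          conj (u p.1) * (conj (F p.1.1 p.2) * v (p.1.1, Fin.cons p.2 p.1.2)) :=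
        (integral_prod _ (integrable_kernel_splitFirst_symm h)).symm
    _ = ∫ p, kernel F u v ((splitFirst d n).symm p) :=
        integral_congr_ae (Eventually.of_forall fun p => (kernel_splitFirst_symm F u v p).symm)
    _ = ∫ y, kernel F u v y :=
        measurePreserving_splitFirst.symm.integral_comp
          (splitFirst d n).symm.measurableEmbedding _

lemma lintegral_enorm_kernel (hF : Measurable (Function.uncurry F)) (hu : Measurable u)
    (hv : Measurable v) :
    ∫⁻ y, ‖kernel F u v y‖ₑ = ∫⁻ x : Config d n, ∫⁻ k : Rd d,
      ‖u x‖ₑ * ‖F x.1 k‖ₑ * ‖v (x.1, Fin.cons k x.2)‖ₑ := by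
  have hmeas := (measurable_kernel hF hu hv).enorm
  refine (measurePreserving_splitFirst.symm.lintegral_comp hmeas).symm.trans ?_
  refine (lintegral_prod _ (hmeas.comp (splitFirst d n).symm.measurable).aemeasurable).trans ?_
  refine lintegral_congr fun x => lintegral_congr fun k => ?_
  rw [Function.comp_apply, kernel_splitFirst_symm, enorm_mul, enorm_mul, RCLike.enorm_conj,
    RCLike.enorm_conj, mul_assoc]

/-- Since `v` is symmetric, the annihilated boson may be relabelled as the `i`-th one; this turns
the annihilation operator into the `i`-th summand of the creation operator. -/
lemma conj_kernel_comp_permute_ae_eq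
    (hv : ∀ σ, (fun y => v (permute d (n + 1) σ y)) =ᵐ[volume] v) (i : Fin (n + 1)) :
    (fun y => conj (kernel F u v (permute d (n + 1) i.cycleRange.symm y))) =ᵐ[volume]
      fun y => conj (v y) * (F y.1 (y.2 i) * u (y.1, i.removeNth y.2)) := by
  filter_upwards [hv i.cycleRange.symm] with y hy
  have htail : Fin.tail (permute d (n + 1) i.cycleRange.symm y).2 = i.removeNth y.2 := by
    funext l
    simp [Fin.tail, permute, Fin.removeNth, Fin.cycleRange_symm_succ]
  have hhead : (permute d (n + 1) i.cycleRange.symm y).2 0 = y.2 i := by simp [permute]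
  rw [kernel, htail, hhead, hy, show (permute d (n + 1) i.cycleRange.symm y).1 = y.1 from rfl]
  simp only [map_mul, Complex.conj_conj]
  ring

lemma integrable_conj_mul_removeNth (h : Integrable (kernel F u v))
    (hv : ∀ σ, (fun y => v (permute d (n + 1) σ y)) =ᵐ[volume] v) (i : Fin (n + 1)) :
    Integrable fun y => conj (v y) * (F y.1 (y.2 i) * u (y.1, i.removeNth y.2)) :=
  ((measurePreserving_permute d (n + 1) i.cycleRange.symm).integrable_comp_of_integrable
    ((RCLike.conjLIE (K := ℂ)).toLinearIsometry.toContinuousLinearMap.integrable_comp h)).congr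
      (conj_kernel_comp_permute_ae_eq hv i)

lemma integral_conj_mul_removeNth (h : Integrable (kernel F u v))
    (hv : ∀ σ, (fun y => v (permute d (n + 1) σ y)) =ᵐ[volume] v) (i : Fin (n + 1)) :
    ∫ y, conj (v y) * (F y.1 (y.2 i) * u (y.1, i.removeNth y.2)) = conj (∫ y, kernel F u v y) := by
  have hperm := measurePreserving_permute d (n + 1) i.cycleRange.symm
  have hmeas : AEStronglyMeasurable (fun y => conj (kernel F u v y))
      (Measure.map (permute d (n + 1) i.cycleRange.symm) volume) := by
    rw [hperm.map_eq]
    exact Complex.continuous_conj.comp_aestronglyMeasurable h.aestronglyMeasurable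
  rw [← integral_conj, ← integral_congr_ae (conj_kernel_comp_permute_ae_eq hv i),
    ← integral_map hperm.measurable.aemeasurable hmeas, hperm.map_eq]

lemma conj_mul_creation_eq_sum (F : Rd d → Rd d → ℂ) (u : Config d n → ℂ)
    (v : Config d (n + 1) → ℂ) (s : ℂ) (y : Config d (n + 1)) :
    conj (v y) * (s * ((n + 1 : ℂ)⁻¹ * ∑ i : Fin (n + 1), F y.1 (y.2 i) * u (y.1, i.removeNth y.2)))
      = s * (n + 1 : ℂ)⁻¹ *
        ∑ i : Fin (n + 1), conj (v y) * (F y.1 (y.2 i) * u (y.1, i.removeNth y.2)) := by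
  rw [← Finset.mul_sum]
  ring

lemma integrable_conj_mul_creation (h : Integrable (kernel F u v))
    (hv : ∀ σ, (fun y => v (permute d (n + 1) σ y)) =ᵐ[volume] v) (s : ℂ) :
    Integrable fun y => conj (v y) * (s * ((n + 1 : ℂ)⁻¹ *
      ∑ i : Fin (n + 1), F y.1 (y.2 i) * u (y.1, i.removeNth y.2))) := by
  simp only [conj_mul_creation_eq_sum]
  exact (integrable_finsetSum _ fun i _ => integrable_conj_mul_removeNth h hv i).const_mul _

lemma integral_conj_mul_creation (h : Integrable (kernel F u v))
    (hv : ∀ σ, (fun y => v (permute d (n + 1) σ y)) =ᵐ[volume] v) (s : ℂ) :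
    ∫ y, conj (v y) * (s * ((n + 1 : ℂ)⁻¹ *
      ∑ i : Fin (n + 1), F y.1 (y.2 i) * u (y.1, i.removeNth y.2)))
      = s * conj (∫ y, kernel F u v y) := by
  have hn : (n + 1 : ℂ) ≠ 0 := by exact_mod_cast n.succ_ne_zero
  simp only [conj_mul_creation_eq_sum]
  rw [integral_const_mul, integral_finsetSum _ fun i _ => integrable_conj_mul_removeNth h hv i,
    Finset.sum_congr rfl fun i _ => integral_conj_mul_removeNth h hv i, Finset.sum_const,
    Finset.card_univ, Fintype.card_fin, nsmul_eq_mul]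
  push_cast
  field_simp

end Kernel

section Field

variable {d : ℕ} {ħ : ℝ} {F : Rd d → Rd d → ℂ} {φ ψ : Space d}

/-- The sum and integrals that define `⟨φ, a_ħ(F) ψ⟩` converge absolutely. -/
def PairingConverges (F : Rd d → Rd d → ℂ) (φ ψ : Space d) : Prop :=
  (∀ n, Integrable (kernel F (wave φ n) (wave ψ (n + 1)))) ∧
    Summable fun n : ℕ => Real.sqrt (n + 1) * ∫ y, ‖kernel F (wave φ n) (wave ψ (n + 1)) y‖

/-- The matrix element `⟨φ, a_ħ(F) ψ⟩`; its value is meaningful if `PairingConverges F φ ψ`. -/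
def pairing (ħ : ℝ) (F : Rd d → Rd d → ℂ) (φ ψ : Space d) : ℂ :=
  ∑' n : ℕ, (Real.sqrt (ħ * (n + 1)) : ℝ) * ∫ y, kernel F (wave φ n) (wave ψ (n + 1)) y

lemma measurable_wave (ψ : Space d) (n : ℕ) : Measurable (wave ψ n) :=
  (Lp.stronglyMeasurable (component d n ψ)).measurable

lemma norm_pairing_term_le (hħ : 0 ≤ ħ) (F : Rd d → Rd d → ℂ) (φ ψ : Space d) (n : ℕ) :
    ‖((Real.sqrt (ħ * (n + 1)) : ℝ) : ℂ) * ∫ y, kernel F (wave φ n) (wave ψ (n + 1)) y‖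
      ≤ Real.sqrt ħ * (Real.sqrt (n + 1) * ∫ y, ‖kernel F (wave φ n) (wave ψ (n + 1)) y‖) := by
  rw [norm_mul, Complex.norm_of_nonneg (Real.sqrt_nonneg _), Real.sqrt_mul hħ, mul_assoc]
  gcongr
  exact norm_integral_le_integral_norm _

lemma PairingConverges.hasSum (hħ : 0 ≤ ħ) (h : PairingConverges F φ ψ) :
    HasSum (fun n : ℕ => ((Real.sqrt (ħ * (n + 1)) : ℝ) : ℂ)
      * ∫ y, kernel F (wave φ n) (wave ψ (n + 1)) y) (pairing ħ F φ ψ) :=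
  (Summable.of_norm_bounded (h.2.mul_left (Real.sqrt ħ)) (norm_pairing_term_le hħ F φ ψ)).hasSum

lemma conj_wave_mul_annihilate (ħ : ℝ) (F : Rd d → Rd d → ℂ) (φ ψ : Space d) (n : ℕ)
    (x : Config d n) :
    conj (wave φ n x) * annihilate ħ F ψ n x
      = ((Real.sqrt (ħ * (n + 1)) : ℝ) : ℂ) * (conj (wave φ n x) *
        ∫ k : Rd d, conj (F x.1 k) * wave ψ (n + 1) (x.1, Fin.cons k x.2)) :=
  mul_left_comm _ _ _

lemma integrable_conj_mul_annihilate (ħ : ℝ) {n : ℕ}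
    (h : Integrable (kernel F (wave φ n) (wave ψ (n + 1)))) :
    Integrable fun x => conj (wave φ n x) * annihilate ħ F ψ n x := by
  simp only [conj_wave_mul_annihilate]
  exact (integrable_conj_mul_integral h).const_mul _

lemma integral_conj_mul_annihilate (ħ : ℝ) {n : ℕ}
    (h : Integrable (kernel F (wave φ n) (wave ψ (n + 1)))) :
    ∫ x, conj (wave φ n x) * annihilate ħ F ψ n x
      = (Real.sqrt (ħ * (n + 1)) : ℝ) * ∫ y, kernel F (wave φ n) (wave ψ (n + 1)) y := by
  simp only [conj_wave_mul_annihilate]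
  rw [integral_const_mul, integral_conj_mul_integral h]

lemma integrable_conj_mul_create (ħ : ℝ)
    (h : ∀ n, Integrable (kernel F (wave ψ n) (wave φ (n + 1)))) (n : ℕ) :
    Integrable fun x => conj (wave φ n x) * create ħ F ψ n x := by
  cases n with
  | zero => simp [create]
  | succ n => exact integrable_conj_mul_creation (h n) (φ (n + 1)).2 _

lemma hasSum_integral_conj_mul_create (hħ : 0 ≤ ħ) (h : PairingConverges F ψ φ) :
    HasSum (fun n => ∫ x, conj (wave φ n x) * create ħ F ψ n x) (conj (pairing ħ F ψ φ)) := by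
  have hzero : ∫ x : Config d 0, conj (wave φ 0 x) * create ħ F ψ 0 x = 0 := by simp [create]
  rw [← hasSum_nat_add_iff' 1, Finset.sum_range_one, hzero, sub_zero]
  refine ((h.hasSum hħ).map (starRingEnd ℂ) Complex.continuous_conj).congr_fun fun n => ?_
  refine (integral_conj_mul_creation (h.1 n) (φ (n + 1)).2 _).trans ?_
  simp only [Function.comp_apply, map_mul, Complex.conj_ofReal]

lemma integral_conj_mul_segalField (ħ : ℝ) (hφψ : PairingConverges F φ ψ)
    (hψφ : PairingConverges F ψ φ) (n : ℕ) :
    ∫ x : Config d n, conj (wave φ n x) * segalField ħ F ψ n x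
      = ((Real.sqrt (ħ * (n + 1)) : ℝ) * (∫ y, kernel F (wave φ n) (wave ψ (n + 1)) y)
        + ∫ x, conj (wave φ n x) * create ħ F ψ n x) / (Real.sqrt 2 : ℝ) := by
  rw [← integral_conj_mul_annihilate ħ (hφψ.1 n),
    ← integral_add (integrable_conj_mul_annihilate ħ (hφψ.1 n))
      (integrable_conj_mul_create ħ hψφ.1 n), ← integral_div]
  exact integral_congr_ae (Eventually.of_forall fun x => by simp only [segalField]; ring)

lemma hasSum_integral_conj_mul_segalField (hħ : 0 ≤ ħ) (hφψ : PairingConverges F φ ψ)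
    (hψφ : PairingConverges F ψ φ) :
    HasSum (fun n : ℕ => ∫ x : Config d n, conj (wave φ n x) * segalField ħ F ψ n x)
      ((pairing ħ F φ ψ + conj (pairing ħ F ψ φ)) / (Real.sqrt 2 : ℝ)) := by
  simp only [integral_conj_mul_segalField ħ hφψ hψφ]
  exact ((hφψ.hasSum hħ).add (hasSum_integral_conj_mul_create hħ hψφ)).div_const _

lemma pairingConverges_of_lintegral (hF : Measurable (Function.uncurry F))
    (h : (∑' n : ℕ, ENNReal.ofReal (Real.sqrt (n + 1)) * ∫⁻ x : Config d n, ∫⁻ k : Rd d,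
      ‖wave φ n x‖ₑ * ‖F x.1 k‖ₑ * ‖wave ψ (n + 1) (x.1, Fin.cons k x.2)‖ₑ) < ⊤) :
    PairingConverges F φ ψ := by
  have hmeas (n : ℕ) : AEStronglyMeasurable (kernel F (wave φ n) (wave ψ (n + 1))) volume :=
    (measurable_kernel hF (measurable_wave φ n) (measurable_wave ψ (n + 1))).aestronglyMeasurable
  simp only [← lintegral_enorm_kernel hF (measurable_wave φ _) (measurable_wave ψ _)] at h
  have hfin (n : ℕ) : ∫⁻ y, ‖kernel F (wave φ n) (wave ψ (n + 1)) y‖ₑ < ⊤ :=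
    ENNReal.lt_top_of_mul_ne_top_right (ENNReal.ne_top_of_tsum_ne_top h.ne n)
      (ENNReal.ofReal_pos.2 (Real.sqrt_pos.2 (by positivity))).ne'
  refine ⟨fun n => ⟨hmeas n, hfin n⟩, (ENNReal.summable_toReal h.ne).congr fun n => ?_⟩
  rw [ENNReal.toReal_mul, ENNReal.toReal_ofReal (Real.sqrt_nonneg _),
    integral_norm_eq_lintegral_enorm (hmeas n)]

lemma norm_kernel_le_norm_kernel {n : ℕ} {F₀ : Rd d → Rd d → ℂ} (hF : ∀ q k, ‖F q k‖ ≤ ‖F₀ q k‖)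
    (u : Config d n → ℂ) (v : Config d (n + 1) → ℂ) (y : Config d (n + 1)) :
    ‖kernel F u v y‖ ≤ ‖kernel F₀ u v y‖ := by
  simp only [kernel, norm_mul, RCLike.norm_conj]
  gcongr
  exact hF _ _

lemma tendsto_pairing {α : Type*} {l : Filter α} [l.IsCountablyGenerated] (hħ : 0 ≤ ħ)
    {F : α → Rd d → Rd d → ℂ} {F₀ : Rd d → Rd d → ℂ}
    (hF : ∀ a, Measurable (Function.uncurry (F a))) (hle : ∀ a q k, ‖F a q k‖ ≤ ‖F₀ q k‖)
    (hlim : ∀ q k, Tendsto (fun a => F a q k) l (𝓝 (F₀ q k))) (h : PairingConverges F₀ φ ψ) :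
    Tendsto (fun a => pairing ħ (F a) φ ψ) l (𝓝 (pairing ħ F₀ φ ψ)) := by
  have hmeas (a : α) (n : ℕ) :
      AEStronglyMeasurable (kernel (F a) (wave φ n) (wave ψ (n + 1))) volume :=
    (measurable_kernel (hF a) (measurable_wave φ n)
      (measurable_wave ψ (n + 1))).aestronglyMeasurable
  have hdom (a : α) (n : ℕ) := norm_kernel_le_norm_kernel (hle a) (wave φ n) (wave ψ (n + 1))
  refine tendsto_tsum_of_dominated_convergence (h.2.mul_left (Real.sqrt ħ)) (fun n => ?_)
    (Eventually.of_forall fun a n => ?_)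
  · refine (tendsto_integral_filter_of_dominated_convergence _
      (Eventually.of_forall fun a => hmeas a n)
      (Eventually.of_forall fun a => Eventually.of_forall (hdom a n)) (h.1 n).norm
      (Eventually.of_forall fun y => ?_)).const_mul _
    exact (((Complex.continuous_conj.tendsto _).comp (hlim _ _)).const_mul _).mul_const _
  · refine (norm_pairing_term_le hħ (F a) φ ψ n).trans ?_
    gcongr
    · exact ((h.1 n).mono (hmeas a n) (Eventually.of_forall (hdom a n))).norm
    · exact (h.1 n).norm
    · exact hdom a n

end Field

section SquareIntegrable

variable {d : ℕ} {ħ : ℝ} {F : Rd d → Rd d → ℂ} {h : L²(Rd d)} {f : Rd d → ℂ}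

lemma kernel_ae_eq_inner_tensor (hh : h =ᵐ[volume] f) (hF : ∀ q k, F q k = planeWave q k * f k)
    {n : ℕ} (u : L²(Config d n)) (v : L²(Config d (n + 1))) :
    kernel F u v =ᵐ[volume] fun y => inner ℂ (tensor d n h u y) (v y) := by
  filter_upwards [coeFn_tensor h u,
    tensorFun_congr_ae hh (EventuallyEq.refl _ (u : Config d n → ℂ))] with y htensor hfun
  rw [htensor, hfun, RCLike.inner_apply, kernel, tensorFun, hF]
  simp only [map_mul]
  ring

lemma integral_norm_mul_norm_le {E : Type*} [MeasurableSpace E] {μ : Measure E} (f g : Lp ℂ 2 μ) :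
    ∫ y, ‖f y‖ * ‖g y‖ ∂μ ≤ ‖f‖ * ‖g‖ := by
  have hnorm (w : Lp ℂ 2 μ) : (∫ y, ‖w y‖ ^ (2 : ℝ) ∂μ) ^ (1 / (2 : ℝ)) = ‖w‖ := by
    rw [Lp.norm_def, (Lp.memLp w).eLpNorm_eq_integral_rpow_norm (by norm_num) (by norm_num),
      ENNReal.toReal_ofReal (by positivity)]
    norm_num
  have hHolder := integral_mul_norm_le_Lp_mul_Lq (μ := μ) Real.HolderConjugate.two_two
    (f := f) (g := g) (by simpa using Lp.memLp f) (by simpa using Lp.memLp g)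
  rwa [hnorm, hnorm] at hHolder

lemma integral_norm_kernel_le (hh : h =ᵐ[volume] f) (hF : ∀ q k, F q k = planeWave q k * f k)
    {n : ℕ} (u : L²(Config d n)) (v : L²(Config d (n + 1))) :
    ∫ y, ‖kernel F u v y‖ ≤ ‖h‖ * (‖u‖ * ‖v‖) := by
  have hkernel : ∫ y, ‖kernel F u v y‖ = ∫ y, ‖tensor d n h u y‖ * ‖v y‖ := by
    refine integral_congr_ae ?_
    filter_upwards [kernel_ae_eq_inner_tensor hh hF u v] with y hy
    rw [hy, RCLike.inner_apply, norm_mul, RCLike.norm_conj, mul_comm]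
  rw [hkernel, ← mul_assoc, ← norm_tensor]
  exact integral_norm_mul_norm_le _ v

lemma pairing_eq_annForm (hh : h =ᵐ[volume] f) (hF : ∀ q k, F q k = planeWave q k * f k)
    (φ ψ : formDomain d ħ) : pairing ħ F φ ψ = annForm d ħ h φ ψ := by
  refine (tsum_congr fun n => ?_).trans (hasSum_annForm h φ ψ).tsum_eq
  refine congrArg (((Real.sqrt (ħ * (n + 1)) : ℝ) : ℂ) * ·) ?_
  exact (integral_congr_ae (kernel_ae_eq_inner_tensor hh hF (component d n φ)
    (component d (n + 1) ψ))).trans (L2.inner_def _ _).symm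

lemma norm_component_succ_sqrtNumberQ (hħ : 0 ≤ ħ) (ψ : formDomain d ħ) (n : ℕ) :
    ‖component d (n + 1) (sqrtNumberQ d ħ ψ)‖
      = Real.sqrt ħ * (Real.sqrt (n + 1) * ‖component d (n + 1) ψ‖) := by
  rw [component_succ_sqrtNumberQ, norm_smul, Complex.norm_of_nonneg (Real.sqrt_nonneg _),
    Real.sqrt_mul hħ, mul_assoc]

lemma summable_norm_mul_norm_component_succ (φ χ : Space d) :
    Summable fun n => ‖component d n φ‖ * ‖component d (n + 1) χ‖ := by
  have hφ := (hasSum_sq_norm_component φ).summable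
  have hχ := (summable_nat_add_iff 1).2 (hasSum_sq_norm_component χ).summable
  refine (hφ.add hχ).of_nonneg_of_le (fun n => by positivity) fun n => ?_
  have hprod : 0 ≤ ‖component d n φ‖ * ‖component d (n + 1) χ‖ := by positivity
  linarith [two_mul_le_add_sq ‖component d n φ‖ ‖component d (n + 1) χ‖]

lemma pairingConverges_of_square_integrable (hħ : 0 < ħ) (hh : h =ᵐ[volume] f)
    (hF : ∀ q k, F q k = planeWave q k * f k) (φ : Space d) (ψ : formDomain d ħ) :
    PairingConverges F φ ψ := by
  refine ⟨fun n => ?_, ?_⟩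
  · exact (L2.integrable_inner (𝕜 := ℂ) (tensor d n h (component d n φ))
      (component d (n + 1) ψ)).congr
        (kernel_ae_eq_inner_tensor hh hF (component d n φ) (component d (n + 1) ψ)).symm
  · refine ((summable_norm_mul_norm_component_succ φ (sqrtNumberQ d ħ ψ)).mul_left
      (‖h‖ * (Real.sqrt ħ)⁻¹)).of_nonneg_of_le (fun n => by positivity) fun n => ?_
    have hkernel := integral_norm_kernel_le hh hF (component d n φ) (component d (n + 1) ψ)
    refine (mul_le_mul_of_nonneg_left hkernel (Real.sqrt_nonneg _)).trans_eq ?_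
    have hsqrt := (Real.sqrt_pos.2 hħ).ne'
    simp only [norm_component_succ_sqrtNumberQ hħ.le]
    field_simp

end SquareIntegrable

section FormFactor

variable {d : ℕ}

/-- The modulus `|k|^{-(d-1)/2}` of the form factor, as a function of `|k|`. -/
def radialFactor (d : ℕ) (y : ℝ) : ℝ := (y ^ (((d : ℝ) - 1) / 2))⁻¹

/-- The form factor `1_{|k| ≤ Λ} |k|^{-(d-1)/2}` without its plane wave. -/
def lowFactor (d : ℕ) (Λ : ℝ≥0∞) : Rd d → ℂ :=
  {k | ‖k‖ₑ ≤ Λ}.indicator fun k => (radialFactor d ‖k‖ : ℂ)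

/-- The functions `Gⱼ(k) = 1_{|k| > max 1 Λ} kⱼ |k|^{-2} |k|^{-(d-1)/2}`. Multiplied by `kⱼ` and
summed over `j` they give the part of the form factor beyond the cutoff. The maximum keeps them
away from the singularity at `k = 0`. -/
def highFactor (Λ : ℝ≥0) (j : Fin d) : Rd d → ℂ :=
  {k | max 1 Λ < ‖k‖₊}.indicator fun k => ((k j / ‖k‖ ^ 2 * radialFactor d ‖k‖ : ℝ) : ℂ)

lemma formFactor_eq_planeWave_mul (Λ : ℝ≥0∞) (q k : Rd d) :
    formFactor d Λ q k = planeWave q k * lowFactor d Λ k := by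
  simp only [formFactor, lowFactor, planeWave, radialFactor, Set.indicator_apply, mul_ite, mul_zero,
    Complex.ofReal_inv, div_eq_mul_inv]

lemma lowFactor_coe (Λ : ℝ≥0) (k : Rd d) :
    lowFactor d Λ k = if ‖k‖₊ ≤ Λ then (radialFactor d ‖k‖ : ℂ) else 0 := by
  simp [lowFactor, Set.indicator_apply, enorm_le_coe]

lemma highFactor_of_one_le {Λ : ℝ≥0} (hΛ : 1 ≤ Λ) (j : Fin d) (k : Rd d) :
    highFactor Λ j k
      = if ‖k‖₊ ≤ Λ then 0 else ((k j / ‖k‖ ^ 2 * radialFactor d ‖k‖ : ℝ) : ℂ) := by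
  simp only [highFactor, Set.indicator_apply, Set.mem_ofPred_eq, max_eq_right hΛ, ← not_le, ite_not]

lemma measurable_radialFactor_norm (d : ℕ) : Measurable fun k : Rd d => radialFactor d ‖k‖ :=
  (measurable_norm.pow_const _).inv

lemma measurable_lowFactor (d : ℕ) (Λ : ℝ≥0∞) : Measurable (lowFactor d Λ) :=
  (Complex.measurable_ofReal.comp (measurable_radialFactor_norm d)).indicator
    (measurableSet_le measurable_enorm measurable_const)

lemma measurable_highFactor (Λ : ℝ≥0) (j : Fin d) : Measurable (highFactor Λ j) := by
  refine Measurable.indicator (Complex.measurable_ofReal.comp ?_)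
    (measurableSet_lt measurable_const measurable_nnnorm)
  exact (Measurable.div (by fun_prop) (measurable_norm.pow_const 2)).mul
    (measurable_radialFactor_norm d)

lemma measurable_formFactor (d : ℕ) (Λ : ℝ≥0∞) :
    Measurable (Function.uncurry (formFactor d Λ)) := by
  have heq : Function.uncurry (formFactor d Λ)
      = fun p : Rd d × Rd d => planeWave p.1 p.2 * lowFactor d Λ p.2 :=
    funext fun p => formFactor_eq_planeWave_mul Λ p.1 p.2
  rw [heq]
  exact continuous_planeWave.measurable.mul ((measurable_lowFactor d Λ).comp measurable_snd)

lemma formFactor_coe_of_le {Λ : ℝ≥0} {k : Rd d} (hk : ‖k‖₊ ≤ Λ) (q : Rd d) :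
    formFactor d Λ q k = formFactor d ⊤ q k := by
  simp [formFactor_eq_planeWave_mul, lowFactor, enorm_le_coe, hk]

lemma norm_formFactor_le (Λ : ℝ≥0∞) (q k : Rd d) :
    ‖formFactor d Λ q k‖ ≤ ‖formFactor d ⊤ q k‖ :=
  norm_indicator_le_of_subset (s := {k | ‖k‖ₑ ≤ Λ}) (t := {k | ‖k‖ₑ ≤ ⊤})
    (Set.ofPred_subset_ofPred.2 fun _ _ => le_top) _ k

lemma tendsto_formFactor (q k : Rd d) :
    Tendsto (fun Λ : ℝ≥0 => formFactor d Λ q k) atTop (𝓝 (formFactor d ⊤ q k)) :=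
  tendsto_const_nhds.congr' <|
    (eventually_ge_atTop ‖k‖₊).mono fun _ hΛ => (formFactor_coe_of_le hΛ q).symm

lemma pow_mul_radialFactor_sq (hd : 1 ≤ d) {y : ℝ} (hy : 0 < y) :
    y ^ (d - 1) * radialFactor d y ^ 2 = 1 := by
  have hsq : (y ^ (((d : ℝ) - 1) / 2)) ^ 2 = y ^ (d - 1) := by
    rw [← Real.rpow_natCast, ← Real.rpow_mul hy.le, ← Real.rpow_natCast]
    congr 1
    push_cast [Nat.cast_sub hd]
    ring
  rw [radialFactor, inv_pow, hsq]
  exact mul_inv_cancel₀ (pow_pos hy _).ne'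

/-- In polar coordinates `|k|^{-(d-1)}` cancels the Jacobian. -/
lemma integrable_radialFactor_sq_mul (hd : 1 ≤ d) {g : ℝ → ℝ} (hg : IntegrableOn g (Set.Ioi 0)) :
    Integrable fun k : Rd d => radialFactor d ‖k‖ ^ 2 * g ‖k‖ := by
  have : Nonempty (Fin d) := ⟨⟨0, hd⟩⟩
  rw [integrable_fun_norm_addHaar volume (f := fun y => radialFactor d y ^ 2 * g y)]
  refine hg.congr_fun (fun y hy => ?_) measurableSet_Ioi
  simp only [finrank_euclideanSpace, Fintype.card_fin, smul_eq_mul]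
  rw [← mul_assoc, pow_mul_radialFactor_sq hd hy, one_mul]

lemma memLp_lowFactor (hd : 1 ≤ d) (Λ : ℝ≥0) : MemLp (lowFactor d Λ) 2 volume := by
  rw [memLp_two_iff_integrable_sq_norm (measurable_lowFactor d Λ).aestronglyMeasurable]
  have hinteg : IntegrableOn ((Set.Iic (Λ : ℝ)).indicator (1 : ℝ → ℝ)) (Set.Ioi 0) := by
    refine IntegrableOn.integrable_indicator (integrableOn_const ?_) measurableSet_Iic
    rw [Measure.restrict_apply measurableSet_Iic, Set.inter_comm, Set.Ioi_inter_Iic]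
    exact measure_Ioc_lt_top.ne
  refine (integrable_radialFactor_sq_mul hd hinteg).congr (Eventually.of_forall fun k => ?_)
  simp only [lowFactor_coe, Set.indicator_apply, Set.mem_Iic, ← NNReal.coe_le_coe, coe_nnnorm]
  split_ifs <;> simp

lemma norm_sq_highFactor_zero_le (j : Fin d) (k : Rd d) :
    ‖highFactor 0 j k‖ ^ 2
      ≤ radialFactor d ‖k‖ ^ 2 * (Set.Ioi 1).indicator (fun y => y ^ (-2 : ℝ)) ‖k‖ := by
  simp only [highFactor, Set.indicator_apply, Set.mem_ofPred_eq, Set.mem_Ioi, zero_le,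
    sup_of_le_left, ← NNReal.coe_lt_coe, NNReal.coe_one, coe_nnnorm]
  split_ifs with hk
  · have hk0 : 0 < ‖k‖ := one_pos.trans hk
    have hcoord : |k j| / ‖k‖ ^ 2 ≤ ‖k‖⁻¹ := by
      rw [div_le_iff₀ (by positivity), sq, inv_mul_cancel_left₀ hk0.ne']
      exact PiLp.norm_apply_le k j
    rw [Complex.norm_real, norm_mul, norm_div, norm_pow, norm_norm, Real.norm_eq_abs, mul_pow,
      Real.norm_eq_abs, sq_abs, mul_comm, Real.rpow_neg hk0.le, Real.rpow_two, ← inv_pow]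
    gcongr
  · simp

lemma memLp_highFactor_zero (hd : 1 ≤ d) (j : Fin d) : MemLp (highFactor 0 j) 2 volume := by
  have hmeas := (measurable_highFactor 0 j).aestronglyMeasurable (μ := volume)
  have hinteg : IntegrableOn ((Set.Ioi 1).indicator fun y : ℝ => y ^ (-2 : ℝ)) (Set.Ioi 0) :=
    ((integrableOn_Ioi_rpow_of_lt (by norm_num) one_pos).integrable_indicator
      measurableSet_Ioi).integrableOn
  rw [memLp_two_iff_integrable_sq_norm hmeas]
  refine (integrable_radialFactor_sq_mul hd hinteg).mono' (hmeas.norm.pow 2)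
    (Eventually.of_forall fun k => ?_)
  rw [norm_pow, norm_norm]
  exact norm_sq_highFactor_zero_le j k

lemma norm_highFactor_le (Λ : ℝ≥0) (j : Fin d) (k : Rd d) :
    ‖highFactor Λ j k‖ ≤ ‖highFactor 0 j k‖ :=
  norm_indicator_le_of_subset (s := {k | max 1 Λ < ‖k‖₊}) (t := {k | max 1 0 < ‖k‖₊})
    (Set.ofPred_subset_ofPred.2 fun _ => (max_le_max_left 1 zero_le).trans_lt) _ k

lemma memLp_highFactor (hd : 1 ≤ d) (Λ : ℝ≥0) (j : Fin d) : MemLp (highFactor Λ j) 2 volume :=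
  (memLp_highFactor_zero hd j).mono (measurable_highFactor Λ j).aestronglyMeasurable
    (Eventually.of_forall (norm_highFactor_le Λ j))

/-- `lowFactor` as an element of `L²`. -/
def lowLp (hd : 1 ≤ d) (Λ : ℝ≥0) : L²(Rd d) := (memLp_lowFactor hd Λ).toLp _

/-- `highFactor` as an element of `L²`. -/
def highLp (hd : 1 ≤ d) (Λ : ℝ≥0) (j : Fin d) : L²(Rd d) := (memLp_highFactor hd Λ j).toLp _

lemma coeFn_lowLp (hd : 1 ≤ d) (Λ : ℝ≥0) : lowLp hd Λ =ᵐ[volume] lowFactor d Λ :=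
  MemLp.coeFn_toLp _

lemma coeFn_highLp (hd : 1 ≤ d) (Λ : ℝ≥0) (j : Fin d) :
    highLp hd Λ j =ᵐ[volume] highFactor Λ j :=
  MemLp.coeFn_toLp _

lemma tendsto_norm_highLp (hd : 1 ≤ d) (j : Fin d) :
    Tendsto (fun Λ : ℝ≥0 => ‖highLp hd Λ j‖) atTop (𝓝 0) := by
  have hlim (k : Rd d) : Tendsto (fun Λ : ℝ≥0 => highFactor Λ j k) atTop (𝓝 0) := by
    refine tendsto_const_nhds.congr' ?_
    filter_upwards [eventually_ge_atTop ‖k‖₊, eventually_ge_atTop 1] with Λ hk hΛ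
    rw [highFactor_of_one_le hΛ, if_pos hk]
  have h := tendsto_toLp_of_dominated_convergence ENNReal.ofNat_ne_top (memLp_highFactor hd · j)
    MemLp.zero (memLp_highFactor_zero hd j).norm
    (Eventually.of_forall fun Λ => Eventually.of_forall (norm_highFactor_le Λ j))
    (Eventually.of_forall hlim)
  simpa only [MemLp.toLp_zero, norm_zero] using! h.norm

lemma sum_coord_mul_div_sq {k : Rd d} (hk : k ≠ 0) (r : ℝ) :
    ∑ j, (k j : ℂ) * ((k j / ‖k‖ ^ 2 * r : ℝ) : ℂ) = r := by
  have hnorm : ‖k‖ ≠ 0 := norm_ne_zero_iff.2 hk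
  have hreal : ∑ j, k j * (k j / ‖k‖ ^ 2 * r) = r := by
    calc ∑ j, k j * (k j / ‖k‖ ^ 2 * r) = (∑ j, k j ^ 2) * (r / ‖k‖ ^ 2) := by
          rw [Finset.sum_mul]
          exact Finset.sum_congr rfl fun j _ => by ring
      _ = r := by
          rw [← EuclideanSpace.real_norm_sq_eq]
          field_simp
  exact_mod_cast congrArg Complex.ofReal hreal

lemma lowFactor_sub_lowFactor_one {Λ : ℝ≥0} (hΛ : 1 ≤ Λ) (k : Rd d) :
    lowFactor d Λ k - lowFactor d (1 : ℝ≥0) k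
      = ∑ j, (k j : ℂ) * (highFactor 1 j k - highFactor Λ j k) := by
  simp only [lowFactor_coe, highFactor_of_one_le hΛ, highFactor_of_one_le le_rfl]
  by_cases hk1 : ‖k‖₊ ≤ 1
  · simp [hk1, hk1.trans hΛ]
  · have hk0 : k ≠ 0 := by
      rintro rfl
      simp at hk1
    by_cases hkΛ : ‖k‖₊ ≤ Λ
    · simp only [if_neg hk1, if_pos hkΛ, sub_zero, sum_coord_mul_div_sq hk0]
    · simp [hk1, hkΛ]

lemma coeFn_highLp_sub (hd : 1 ≤ d) (Λ Λ' : ℝ≥0) (j : Fin d) :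
    ⇑(highLp hd Λ j - highLp hd Λ' j) =ᵐ[volume] fun k => highFactor Λ j k - highFactor Λ' j k :=
  (Lp.coeFn_sub _ _).trans ((coeFn_highLp hd Λ j).sub (coeFn_highLp hd Λ' j))

lemma coeFn_lowLp_sub_lowLp_one (hd : 1 ≤ d) {Λ : ℝ≥0} (hΛ : 1 ≤ Λ) :
    ⇑(lowLp hd Λ - lowLp hd 1)
      =ᵐ[volume] fun k => ∑ j, (k j : ℂ) * (highLp hd 1 j - highLp hd Λ j) k := by
  filter_upwards [Lp.coeFn_sub (lowLp hd Λ) (lowLp hd 1), coeFn_lowLp hd Λ, coeFn_lowLp hd 1,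
    ae_all_iff.2 fun j => coeFn_highLp_sub hd 1 Λ j] with k hsub hΛk h1k hhigh
  rw [hsub, Pi.sub_apply, hΛk, h1k, lowFactor_sub_lowFactor_one hΛ]
  exact Finset.sum_congr rfl fun j _ => by rw [hhigh j]

lemma highLp_one_sub_ae_eq_zero (hd : 1 ≤ d) {Λ : ℝ≥0} (hΛ : 1 ≤ Λ) (j : Fin d) :
    ∀ᵐ k, (Λ : ℝ) < ‖k‖ → (highLp hd 1 j - highLp hd Λ j) k = 0 := by
  filter_upwards [coeFn_highLp_sub hd 1 Λ j] with k hk hlt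
  have hΛk : ¬ ‖k‖₊ ≤ Λ := not_le.2 hlt
  rw [hk, highFactor_of_one_le le_rfl, highFactor_of_one_le hΛ, if_neg hΛk,
    if_neg fun h => hΛk (h.trans hΛ), sub_self]

end FormFactor

section Interaction

variable {d : ℕ} {ħ : ℝ}

lemma interaction_eq_of_converges (hħ : 0 ≤ ħ) {Λ : ℝ≥0∞} {φ ψ : Space d}
    (hφψ : PairingConverges (formFactor d Λ) φ ψ) (hψφ : PairingConverges (formFactor d Λ) ψ φ) :
    interaction d ħ Λ φ ψ
      = (pairing ħ (formFactor d Λ) φ ψ + conj (pairing ħ (formFactor d Λ) ψ φ))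
        / (Real.sqrt 2 : ℝ) :=
  (hasSum_integral_conj_mul_segalField hħ hφψ hψφ).tsum_eq

lemma pairingConverges_formFactor (hħ : 0 < ħ) (hd : 1 ≤ d) (Λ : ℝ≥0) (φ : Space d)
    (ψ : formDomain d ħ) : PairingConverges (formFactor d Λ) φ ψ :=
  pairingConverges_of_square_integrable hħ (coeFn_lowLp hd Λ) (formFactor_eq_planeWave_mul Λ) φ ψ

/-- The form of `a_ħ(f^∞_q̂)` on `Q(H_ħ⁰)`, split into frequencies below and above `1`. -/
def limitForm (ħ : ℝ) (hd : 1 ≤ d) : SesqForm (formDomain d ħ) :=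
  annForm d ħ (lowLp hd 1) + ∑ j, commForm d ħ j (highLp hd 1 j)

lemma limitForm_eq (hħ : ħ ≠ 0) (hd : 1 ≤ d) {Λ : ℝ≥0} (hΛ : 1 ≤ Λ) :
    limitForm ħ hd = annForm d ħ (lowLp hd Λ) + ∑ j, commForm d ħ j (highLp hd Λ j) := by
  have hshift : annForm d ħ (lowLp hd Λ - lowLp hd 1)
      = ∑ j, commForm d ħ j (highLp hd 1 j - highLp hd Λ j) :=
    annForm_sum_mul_coord hħ (highLp_one_sub_ae_eq_zero hd hΛ) (coeFn_lowLp_sub_lowLp_one hd hΛ)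
  have hdiff : annForm d ħ (lowLp hd Λ) - annForm d ħ (lowLp hd 1)
      = ∑ j, commForm d ħ j (highLp hd 1 j) - ∑ j, commForm d ħ j (highLp hd Λ j) := by
    simp only [← Finset.sum_sub_distrib, ← commForm_sub]
    exact (hopForm_sub _ _ _ _).symm.trans hshift
  exact (add_comm _ _).trans (sub_eq_sub_iff_add_eq_add.1 hdiff).symm

lemma tendsto_commForm_highLp (hħ : 0 ≤ ħ) (hd : 1 ≤ d) (j : Fin d) (φ ψ : formDomain d ħ) :
    Tendsto (fun Λ : ℝ≥0 => commForm d ħ j (highLp hd Λ j) φ ψ) atTop (𝓝 0) := by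
  refine squeeze_zero_norm (fun Λ => norm_commForm_le hħ j (highLp hd Λ j) φ ψ) ?_
  have hlim (c : ℝ) : Tendsto (fun Λ : ℝ≥0 => ħ⁻¹ * ‖highLp hd Λ j‖ * c) atTop (𝓝 0) := by
    simpa using ((tendsto_norm_highLp hd j).const_mul ħ⁻¹).mul_const c
  exact hlim _

lemma tendsto_pairing_formFactor (hħ : 0 < ħ) (hd : 1 ≤ d) (φ ψ : formDomain d ħ) :
    Tendsto (fun Λ : ℝ≥0 => pairing ħ (formFactor d Λ) (φ : Space d) ψ) atTop
      (𝓝 (limitForm ħ hd φ ψ)) := by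
  have hhigh : Tendsto (fun Λ : ℝ≥0 => ∑ j, commForm d ħ j (highLp hd Λ j) φ ψ) atTop (𝓝 0) := by
    simpa only [Finset.sum_const_zero] using
      tendsto_finsetSum Finset.univ fun j _ => tendsto_commForm_highLp hħ.le hd j φ ψ
  have hlow := (tendsto_const_nhds (x := limitForm ħ hd φ ψ)).sub hhigh
  rw [sub_zero] at hlow
  refine hlow.congr' ?_
  filter_upwards [eventually_ge_atTop 1] with Λ hΛ
  have heval := congrArg (fun B : SesqForm (formDomain d ħ) => B φ ψ) (limitForm_eq hħ.ne' hd hΛ)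
  simp only [LinearMap.add_apply, LinearMap.sum_apply] at heval
  exact (sub_eq_of_eq_add heval).trans
    (pairing_eq_annForm (coeFn_lowLp hd Λ) (formFactor_eq_planeWave_mul Λ) φ ψ).symm

lemma tendsto_interaction (hħ : 0 < ħ) (hd : 1 ≤ d) (φ ψ : formDomain d ħ) :
    Tendsto (fun Λ : ℝ≥0 => interaction d ħ (Λ : ℝ≥0∞) φ ψ) atTop
      (𝓝 (hermitize (limitForm ħ hd) φ ψ)) := by
  have hφψ := tendsto_pairing_formFactor hħ hd φ ψ
  have hψφ := (Complex.continuous_conj.tendsto _).comp (tendsto_pairing_formFactor hħ hd ψ φ)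
  exact ((hφψ.add hψφ).div_const _).congr fun Λ =>
    (interaction_eq_of_converges hħ.le (pairingConverges_formFactor hħ hd Λ φ ψ)
      (pairingConverges_formFactor hħ hd Λ ψ φ)).symm

lemma limitForm_eq_pairing (hħ : 0 < ħ) (hd : 1 ≤ d) {φ ψ : formDomain d ħ}
    (h : PairingConverges (formFactor d ⊤) (φ : Space d) ψ) :
    limitForm ħ hd φ ψ = pairing ħ (formFactor d ⊤) (φ : Space d) ψ :=
  tendsto_nhds_unique (tendsto_pairing_formFactor hħ hd φ ψ)
    (tendsto_pairing hħ.le (fun Λ : ℝ≥0 => measurable_formFactor d Λ)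
      (fun Λ => norm_formFactor_le Λ) tendsto_formFactor h)

lemma hermitize_limitForm_eq_interaction (hħ : 0 < ħ) (hd : 1 ≤ d) (φ ψ : formDomain d ħ)
    (hφψ : AnnihilationConverges d (φ : Space d) (ψ : Space d))
    (hψφ : AnnihilationConverges d (ψ : Space d) (φ : Space d)) :
    hermitize (limitForm ħ hd) φ ψ = interaction d ħ ⊤ φ ψ := by
  have hφψ' := pairingConverges_of_lintegral (measurable_formFactor d ⊤) hφψ
  have hψφ' := pairingConverges_of_lintegral (measurable_formFactor d ⊤) hψφ
  rw [interaction_eq_of_converges hħ.le hφψ' hψφ', hermitize_apply,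
    limitForm_eq_pairing hħ hd hφψ', limitForm_eq_pairing hħ hd hψφ']

lemma isInfinitesimallyFormBounded_limitForm (hħ : 0 < ħ) (hd : 1 ≤ d) :
    IsInfinitesimallyFormBounded (limitForm ħ hd) (freeForm d ħ) := by
  refine isInfinitesimallyFormBounded_of_eq_annForm_add_sum_commForm hħ fun δ hδ => ?_
  have hev : ∀ᶠ Λ : ℝ≥0 in atTop, 1 ≤ Λ ∧ ∀ j, ‖highLp hd Λ j‖ < δ :=
    (eventually_ge_atTop 1).and
      (eventually_all.2 fun j => (tendsto_norm_highLp hd j).eventually_lt_const hδ)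
  obtain ⟨Λ, hΛ, hsmall⟩ := hev.exists
  exact ⟨lowLp hd Λ, highLp hd Λ, fun j => (hsmall j).le, limitForm_eq hħ.ne' hd hΛ⟩

end Interaction

end Polaron

end

theorem propositionA1_general (d : ℕ) (hd : 1 ≤ d) (ħ : ℝ) (hħ : 0 < ħ) :
    Dense (formDomain d ħ : Set (Space d)) ∧
    ∃ w : SesqForm (formDomain d ħ),
      (∀ φ ψ : formDomain d ħ,
        Tendsto (fun Λ : ℝ≥0 => interaction d ħ (Λ : ℝ≥0∞) φ ψ) atTop (𝓝 (w φ ψ))) ∧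
      (∀ φ ψ : formDomain d ħ, AnnihilationConverges d (φ : Space d) (ψ : Space d) →
        AnnihilationConverges d (ψ : Space d) (φ : Space d) →
        w φ ψ = interaction d ħ ⊤ φ ψ) ∧
      IsInfinitesimallyFormBounded w (freeForm d ħ) ∧
      IsHermitianForm (freeForm d ħ + w) ∧
      IsBoundedBelowForm (freeForm d ħ + w) ∧
      IsClosedForm (freeForm d ħ + w) := by
  have hw := (isInfinitesimallyFormBounded_limitForm hħ hd).hermitize
  exact ⟨dense_formDomain d ħ, hermitize (limitForm ħ hd), tendsto_interaction hħ hd,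
    hermitize_limitForm_eq_interaction hħ hd, hw,
    (isHermitianForm_freeForm d ħ).add (isHermitianForm_hermitize _),
    hw.isBoundedBelowForm_add (freeForm_self_nonneg ħ),
    hw.isClosedForm_add (freeForm_self_nonneg ħ) (isClosedForm_freeForm d ħ)⟩

/-- For every `ħ ∈ (0,1)` the interaction without cutoff is a Hermitian form `w` on `Q(H_ħ⁰)`: it is
the limit `Λ → ∞` of the interactions with cutoff `Λ`, it is given by the expression with `Λ = ∞`
wherever that expression converges absolutely, and it is infinitesimally form-bounded with respect
to `H_ħ⁰`. The form `H_ħ^∞ = H_ħ⁰ + w`, with the dense form domain `Q(H_ħ⁰)`, is Hermitian, bounded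
below and closed. -/
theorem propositionA1 (d : ℕ) (hd : 1 ≤ d) (ħ : ℝ) (hħ0 : 0 < ħ) (hħ1 : ħ < 1) :
    Dense (formDomain d ħ : Set (Space d)) ∧
    ∃ w : SesqForm (formDomain d ħ),
      (∀ φ ψ : formDomain d ħ,
        Tendsto (fun Λ : ℝ≥0 => interaction d ħ (Λ : ℝ≥0∞) φ ψ) atTop (𝓝 (w φ ψ))) ∧
      (∀ φ ψ : formDomain d ħ, AnnihilationConverges d (φ : Space d) (ψ : Space d) →
        AnnihilationConverges d (ψ : Space d) (φ : Space d) →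
        w φ ψ = interaction d ħ ⊤ φ ψ) ∧
      IsInfinitesimallyFormBounded w (freeForm d ħ) ∧
      IsHermitianForm (freeForm d ħ + w) ∧
      IsBoundedBelowForm (freeForm d ħ + w) ∧
      IsClosedForm (freeForm d ħ + w) :=
  propositionA1_general d hd ħ hħ0
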